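/- Let $n,k\ge 0$ be integers, let $M$ be a smooth manifold (Hausdorff, second countable, without boundary) of dimension $n+k$, and let $\Sigma\subset M$ be a compact smoothly embedded submanifold without boundary of dimension $n$. Let $g$ and $\hat g=e^{2\omega}g$ be smooth Riemannian metrics on $M$, where $\omega\in C^\infty(M)$. For $p\in M$ let $t(p)$ and $\hat t(p)$ be the distances from $p$ to $\Sigma$ with respect to $g$ and $\hat g$, that is, the infima of the $g$-lengths, respectively $\hat g$-lengths, of $C^1$ paths in $M$ from $p$ to a point of $\Sigma$. Then there is an open neighborhood $U$ of $\Sigma$ in $M$ such that $t$ and $\hat t$ are positive and finite on $U\setminus\Sigma$, and there is a function $\Psi\in C^\infty(U)$ such that \[ \Psi=\frac{\hat t}{t}\quad\text{on } U\setminus\Sigma,\qquad \Psi|_\Sigma=e^{\omega}|_\Sigma . \] In other words, $\hat t/t$ extends to a smooth function on a neighborhood of $\Sigma$ in $M$ whose restriction to $\Sigma$ equals $e^{\omega}$. -/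

import Mathlib

open scoped Manifold ContDiff Bundle

/-- A smooth (`C^∞`) Riemannian metric on a smooth manifold `M` of dimension `m`: a smooth,
symmetric, positive definite section of bilinear forms on the tangent bundle. -/
abbrev SmoothRiemannianMetric (m : ℕ) (M : Type*) [TopologicalSpace M]
    [ChartedSpace (EuclideanSpace ℝ (Fin m)) M] [IsManifold (𝓡 m) ∞ M] :=
  Bundle.ContMDiffRiemannianMetric (𝓡 m) ∞ (EuclideanSpace ℝ (Fin m))
    (fun x : M => TangentSpace (𝓡 m) x)

/-- `IsConformalChange φ g g'` says that `g' = e^{2φ} g`, where `φ` is a smooth function. -/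
structure IsConformalChange {m : ℕ} {M : Type*} [TopologicalSpace M]
    [ChartedSpace (EuclideanSpace ℝ (Fin m)) M] [IsManifold (𝓡 m) ∞ M]
    (φ : M → ℝ) (g g' : SmoothRiemannianMetric m M) : Prop where
  smooth : ContMDiff (𝓡 m) 𝓘(ℝ) ∞ φ
  inner_eq : ∀ (x : M) (v w : TangentSpace (𝓡 m) x),
    g'.inner x v w = Real.exp (2 * φ x) * g.inner x v w

/-- The Riemannian distance of the metric `g`: the infimum of the `g`-lengths of the `C^1` paths
from `p` to `q` (it is `∞` if there is no such path). -/
noncomputable def metricEDist {m : ℕ} {M : Type*} [TopologicalSpace M]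
    [ChartedSpace (EuclideanSpace ℝ (Fin m)) M] [IsManifold (𝓡 m) ∞ M]
    (g : SmoothRiemannianMetric m M) (p q : M) : ENNReal :=
  letI : Bundle.RiemannianBundle (fun x : M => TangentSpace (𝓡 m) x) := ⟨g.toRiemannianMetric⟩
  Manifold.riemannianEDist (𝓡 m) p q

/-- The `g`-distance from the point `p` to the set `A`, as an extended nonnegative real. -/
noncomputable def metricInfEDist {m : ℕ} {M : Type*} [TopologicalSpace M]
    [ChartedSpace (EuclideanSpace ℝ (Fin m)) M] [IsManifold (𝓡 m) ∞ M]
    (g : SmoothRiemannianMetric m M) (A : Set M) (p : M) : ENNReal :=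
  ⨅ q ∈ A, metricEDist g p q

/-!
The idea is to treat both metrics by one family of smooth flows. Let `g` have coefficients `G` in a
chart in which the submanifold is the slice `E × 0` of a product `E × F`, let `B` be the inverse
of `G`, and let `P` be the conformal factor `e^{2φ}`. Newtonian motion with Hamiltonian
`½ ξ(B ξ) - ½ κ P` and coupling constant `κ` gives the geodesics of `g` for `κ = 0`, and, by
Maupertuis' principle, the geodesics of `P g` (up to parametrization) when the energy vanishes.
The flow depends smoothly on position, momentum and `κ` together (`exists_smooth_flow`).

Trajectories leaving the slice in the conormal direction `η`, for a small time `s`, sweep out a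
neighborhood of the slice. For `κ = 0` the squared distance to the slice at the end point is
`s² |η|²`. For energy zero, that is `κ = ε := |η|² / P`, the squared distance for `P g` is
`s² ε S²`, where `S` is the integral of `P` along the trajectory. Both facts follow from the first
variation formula `momentum_apply_fderiv_flow`, a form of the Gauss lemma: the candidates satisfy
the eikonal equation, so their square roots grow no faster than length, while the trajectories
themselves have the right length (`IsEikonalSquare`, `exists_isEikonalSquare_geodesic`,
`exists_isEikonalSquare_zeroEnergy`).

The quotient is then found by varying `κ` between the two cases. The squared `g`-distance of the
end point, as a function of `η` and `κ`, is `s² |η|² + κ Q(η, κ)` with `Q` smooth, by Hadamard's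
lemma. At `κ = ε` it is `ε (s² P + Q(η, ε))`, so that the quotient of the squared distances is
`s² S² / (s² P + Q(η, ε))`: the factor `ε`, which vanishes on the slice, cancels. On the slice
`Q = 0` and `S = P`, whence the value `P` there (`exists_isEikonalSquare_conformal`).

Finally, near a point of the submanifold, short paths stay in the chart, and so the solutions of the
eikonal equation are the squared distances to the whole submanifold
(`IsEikonalSquare.eventually_metricInfEDist_eq`). The local quotients agree with the global one,
hence with each other.
-/

section

open Set Filter Topology

universe u

-- nested spaces of continuous linear maps need deeper instance synthesis
set_option maxSynthPendingDepth 3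

/-! ### Superposition operators on spaces of curves -/

section Superposition

variable {K : Type*} [TopologicalSpace K] [CompactSpace K]
  {X Y : Type u} [NormedAddCommGroup X] [NormedSpace ℝ X] [NormedAddCommGroup Y] [NormedSpace ℝ Y]

/-- Pointwise application of a bounded bilinear map to a pair of continuous functions, as a bounded
bilinear map. -/
noncomputable def pointwiseBilin (K : Type*) [TopologicalSpace K] [CompactSpace K]
    {A X Y : Type*} [NormedAddCommGroup A] [NormedSpace ℝ A] [NormedAddCommGroup X]
    [NormedSpace ℝ X] [NormedAddCommGroup Y] [NormedSpace ℝ Y] (b : A →L[ℝ] X →L[ℝ] Y) :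
    C(K, A) →L[ℝ] C(K, X) →L[ℝ] C(K, Y) :=
  LinearMap.mkContinuous₂
    (LinearMap.mk₂ ℝ (fun (α : C(K, A)) (h : C(K, X)) =>
      (⟨fun k => b (α k) (h k), by fun_prop⟩ : C(K, Y)))
      (fun A B h => by ext; simp) (fun c A h => by ext; simp)
      (fun A h h' => by ext; simp) (fun c A h => by ext; simp)) ‖b‖
    (fun α h => by
      refine (ContinuousMap.norm_le _ (by positivity)).2 fun k => ?_
      refine (b.le_opNorm₂ _ _).trans ?_
      gcongr
      · exact α.norm_coe_le_norm k
      · exact h.norm_coe_le_norm k)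

/-- Pointwise application of a continuous family of operators to a continuous family of vectors,
as a bounded bilinear map. -/
noncomputable def pointwiseApply (K : Type*) [TopologicalSpace K] [CompactSpace K]
    (X Y : Type u) [NormedAddCommGroup X] [NormedSpace ℝ X] [NormedAddCommGroup Y]
    [NormedSpace ℝ Y] : C(K, X →L[ℝ] Y) →L[ℝ] C(K, X) →L[ℝ] C(K, Y) :=
  pointwiseBilin K (ContinuousLinearMap.id ℝ (X →L[ℝ] Y))

@[simp] lemma pointwiseApply_apply (A : C(K, X →L[ℝ] Y)) (h : C(K, X)) (k : K) :
    pointwiseApply K X Y A h k = A k (h k) := rfl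

/-- The superposition operator `γ ↦ f ∘ γ` on continuous functions over a compact space. -/
noncomputable def superpose (K : Type*) [TopologicalSpace K] [CompactSpace K] {f : X → Y}
    (hf : Continuous f) (γ : C(K, X)) : C(K, Y) :=
  (⟨f, hf⟩ : C(X, Y)).comp γ

omit [NormedSpace ℝ X] [NormedSpace ℝ Y] in
@[simp] lemma superpose_apply {f : X → Y} (hf : Continuous f) (γ : C(K, X)) (k : K) :
    superpose K hf γ k = f (γ k) := rfl

omit [NormedSpace ℝ X] [NormedSpace ℝ Y] in
lemma continuous_superpose {f : X → Y} (hf : Continuous f) : Continuous (superpose K hf) :=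
  ContinuousMap.continuous_postcomp _

/-- The superposition operator of a `C¹` map is differentiable, and its derivative is pointwise
application of the derivative. The mean value inequality applies uniformly in the point because the
superposition operator of the derivative is continuous for the sup norm. -/
lemma hasFDerivAt_superpose {f : X → Y} {f' : X → X →L[ℝ] Y} (hf : ∀ x, HasFDerivAt f (f' x) x)
    (hfc : Continuous f) (hf' : Continuous f') (γ : C(K, X)) :
    HasFDerivAt (superpose K hfc) (pointwiseApply K X Y (superpose K hf' γ)) γ := by
  rw [hasFDerivAt_iff_isLittleO_nhds_zero, Asymptotics.isLittleO_iff]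
  intro ε hε
  have hc : ContinuousAt (superpose K hf') γ := (continuous_superpose hf').continuousAt
  obtain ⟨δ, hδ, hball⟩ := Metric.continuousAt_iff.1 hc ε hε
  filter_upwards [Metric.ball_mem_nhds (0 : C(K, X)) hδ] with h hh
  refine (ContinuousMap.norm_le _ (by positivity)).2 fun k => ?_
  have hseg : ∀ z ∈ segment ℝ (γ k) (γ k + h k), ‖f' z - f' (γ k)‖ ≤ ε := by
    intro z hz
    rw [segment_eq_image'] at hz
    obtain ⟨t, ht, rfl⟩ := hz
    have h1 : dist (γ + t • h) γ < δ := by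
      rw [dist_eq_norm, add_sub_cancel_left, norm_smul, Real.norm_of_nonneg ht.1]
      have : ‖h‖ < δ := by simpa using hh
      nlinarith [norm_nonneg h, ht.2]
    have h2 := (ContinuousMap.dist_apply_le_dist (f := superpose K hf' (γ + t • h))
      (g := superpose K hf' γ) k).trans (hball h1).le
    rw [dist_eq_norm] at h2
    simpa using h2
  have := (convex_segment (𝕜 := ℝ) (γ k) (γ k + h k)).norm_image_sub_le_of_norm_hasFDerivWithin_le'
    (f := f) (f' := f') (φ := f' (γ k)) (fun z _ => (hf z).hasFDerivWithinAt) hseg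
    (left_mem_segment ℝ _ _) (right_mem_segment ℝ _ _)
  simp only [add_sub_cancel_left] at this
  simpa using this.trans (mul_le_mul_of_nonneg_left (h.norm_coe_le_norm k) hε.le)

/-- The superposition operator of a smooth map is smooth. -/
lemma contDiff_superpose {f : X → Y} (hf : ContDiff ℝ ∞ f) :
    ContDiff ℝ ∞ (superpose K hf.continuous) := by
  rw [contDiff_infty]
  intro n
  induction n generalizing Y with
  | zero => exact contDiff_zero.2 (continuous_superpose _)
  | succ n ih =>
    have hf' : ContDiff ℝ ∞ (fderiv ℝ f) := hf.fderiv_right (by simp)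
    have hc : ContDiff ℝ n (fun γ => pointwiseApply K X Y (superpose K hf'.continuous γ)) :=
      ContDiff.comp (g := fun A => pointwiseApply K X Y A) (by fun_prop) (ih hf')
    refine contDiff_succ_iff_hasFDerivAt.2 ⟨_, hc, fun γ => ?_⟩
    exact hasFDerivAt_superpose
      (fun x => ((hf.differentiable (by simp)) x).hasFDerivAt) hf.continuous _ γ

end Superposition

/-! ### Primitives of curves -/

section Primitive

variable {W : Type*} [NormedAddCommGroup W] [NormedSpace ℝ W]

/-- The primitive vanishing at `0` of a continuous curve on the unit interval, as a continuous
linear map. -/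
noncomputable def primitive (W : Type*) [NormedAddCommGroup W] [NormedSpace ℝ W] :
    C(unitInterval, W) →L[ℝ] C(unitInterval, W) :=
  LinearMap.mkContinuous
    { toFun := fun γ => ⟨fun τ => ∫ r in (0 : ℝ)..τ, γ (projIcc 0 1 zero_le_one r), by
        have hc : Continuous fun r => γ (projIcc 0 1 zero_le_one r) := by fun_prop
        exact (intervalIntegral.continuous_primitive
          (fun a b => hc.intervalIntegrable a b) 0).comp continuous_subtype_val⟩
      map_add' := fun γ δ => by
        ext τ
        simp only [ContinuousMap.coe_mk, ContinuousMap.add_apply]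
        exact intervalIntegral.integral_add (Continuous.intervalIntegrable (by fun_prop) _ _)
          (Continuous.intervalIntegrable (by fun_prop) _ _)
      map_smul' := fun c γ => by
        ext τ
        simp }
    1 (fun γ => by
      rw [one_mul]
      refine (ContinuousMap.norm_le _ (by positivity)).2 fun τ => ?_
      refine (intervalIntegral.norm_integral_le_of_norm_le_const
        (fun r _ => γ.norm_coe_le_norm _)).trans ?_
      rw [sub_zero, abs_of_nonneg τ.2.1]
      exact mul_le_of_le_one_right (norm_nonneg _) τ.2.2)

lemma primitive_apply (γ : C(unitInterval, W)) (τ : unitInterval) :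
    primitive W γ τ = ∫ r in (0 : ℝ)..τ, γ (projIcc 0 1 zero_le_one r) := rfl

lemma primitive_zero (γ : C(unitInterval, W)) : primitive W γ 0 = 0 := by
  simp [primitive_apply]

/-- The constant curves, as a continuous linear map. -/
noncomputable def constCurve (W : Type*) [NormedAddCommGroup W] [NormedSpace ℝ W] :
    W →L[ℝ] C(unitInterval, W) :=
  LinearMap.mkContinuous
    { toFun := fun w => ContinuousMap.const _ w
      map_add' := fun _ _ => rfl
      map_smul' := fun _ _ => rfl } 1
    (fun w => by
      rw [one_mul]
      exact (ContinuousMap.norm_le _ (by positivity)).2 fun τ => le_rfl)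

@[simp] lemma constCurve_apply (w : W) (τ : unitInterval) : constCurve W w τ = w := rfl

lemma hasDerivAt_of_eq_primitive [CompleteSpace W] {γ β : C(unitInterval, W)} {c : W} {s : ℝ}
    (h : γ = constCurve W c + s • primitive W β) {τ : ℝ} (hτ : τ ∈ Ioo (0 : ℝ) 1) :
    HasDerivAt (fun r => γ (projIcc 0 1 zero_le_one r)) (s • β (projIcc 0 1 zero_le_one τ)) τ := by
  have hc : Continuous fun r => β (projIcc 0 1 zero_le_one r) := by fun_prop
  have h1 := ((intervalIntegral.integral_hasDerivAt_right (hc.intervalIntegrable 0 τ)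
    hc.aestronglyMeasurable.stronglyMeasurableAtFilter hc.continuousAt).const_smul s).const_add c
  refine h1.congr_of_eventuallyEq ?_
  filter_upwards [Ioo_mem_nhds hτ.1 hτ.2] with r hr
  have : (projIcc (0 : ℝ) 1 zero_le_one r : ℝ) = r := by
    rw [projIcc_of_mem zero_le_one ⟨hr.1.le, hr.2.le⟩]
  rw [h]
  simp [primitive_apply, this]

end Primitive

/-! ### Inverse functions and cutoffs -/

section InverseFunction

variable {X Y : Type*} [NormedAddCommGroup X] [NormedSpace ℝ X] [CompleteSpace X]
  [NormedAddCommGroup Y] [NormedSpace ℝ Y]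

/-- The inverse function theorem for a smooth map on an open set, with a local inverse that is
smooth on the whole of its domain. -/
lemma exists_openPartialHomeomorph_contDiffOn_symm {Θ : X → Y} {N : Set X}
    (hN : IsOpen N) (hΘ : ContDiffOn ℝ ∞ Θ N) {a : X} (ha : a ∈ N) (D : X ≃L[ℝ] Y)
    (hD : fderiv ℝ Θ a = D) :
    ∃ e : OpenPartialHomeomorph X Y, a ∈ e.source ∧ e.source ⊆ N ∧ (e : X → Y) = Θ ∧
      ContDiffOn ℝ ∞ e.symm e.target := by
  have hat : ∀ x ∈ N, ContDiffAt ℝ ∞ Θ x := fun x hx => hΘ.contDiffAt (hN.mem_nhds hx)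
  have hs : HasStrictFDerivAt Θ (D : X →L[ℝ] Y) a := by
    rw [← hD]; exact (hat a ha).hasStrictFDerivAt (by simp)
  let O : Set X := N ∩ fderiv ℝ Θ ⁻¹' range ((↑) : (X ≃L[ℝ] Y) → X →L[ℝ] Y)
  have hO : IsOpen O :=
    (hΘ.continuousOn_fderiv_of_isOpen hN (by simp)).isOpen_inter_preimage hN
      ContinuousLinearEquiv.isOpen
  let e0 := hs.toOpenPartialHomeomorph Θ
  let e := e0.restrOpen O hO
  refine ⟨e, ⟨hs.mem_toOpenPartialHomeomorph_source, ha, D, hD.symm⟩,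
    fun x hx => hx.2.1, rfl, ?_⟩
  intro y hy
  obtain ⟨D', hD'⟩ := (e.map_target hy).2.2
  have hx := (e.map_target hy).2.1
  refine (e.contDiffAt_symm hy (f₀' := D') ?_ (hat _ hx)).contDiffWithinAt
  change HasFDerivAt Θ (D' : X →L[ℝ] Y) _
  rw [hD']
  exact ((hat _ hx).differentiableAt (by simp)).hasFDerivAt

end InverseFunction

section Cutoff

/-- A function smooth on an open set of a finite-dimensional space agrees near any given point with
a globally smooth function. -/
lemma exists_contDiff_eqOn_nhds {X Y : Type*} [NormedAddCommGroup X] [NormedSpace ℝ X]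
    [FiniteDimensional ℝ X] [NormedAddCommGroup Y] [NormedSpace ℝ Y] {f : X → Y} {O : Set X}
    (hO : IsOpen O) (hf : ContDiffOn ℝ ∞ f O) {x : X} (hx : x ∈ O) :
    ∃ f' : X → Y, ContDiff ℝ ∞ f' ∧ ∃ r > 0, Metric.ball x r ⊆ O ∧
      EqOn f' f (Metric.ball x r) := by
  obtain ⟨R, hR, hRO⟩ := Metric.isOpen_iff.1 hO x hx
  let b : ContDiffBump x := ⟨R / 4, R / 2, by positivity, by linarith⟩
  refine ⟨fun z => b z • f z, ?_, R / 4, by positivity,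
    (Metric.ball_subset_ball (by linarith)).trans hRO, fun z hz => ?_⟩
  · rw [contDiff_iff_contDiffAt]
    intro z
    by_cases hz : z ∈ O
    · exact b.contDiff.contDiffAt.smul (hf.contDiffAt (hO.mem_nhds hz))
    · have hz' : z ∉ tsupport b := by
        rw [b.tsupport_eq]
        intro h
        exact hz (hRO (Metric.closedBall_subset_ball (by simp only [b]; linarith) h))
      have : (fun z => b z • f z) =ᶠ[𝓝 z] fun _ => 0 := by
        filter_upwards [notMem_tsupport_iff_eventuallyEq.1 hz'] with y hy
        simp [hy]
      exact contDiffAt_const.congr_of_eventuallyEq this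
  · have : b z = 1 := b.one_of_mem_closedBall (Metric.ball_subset_closedBall hz)
    simp [this]

end Cutoff

/-! ### Smooth local flows of vector fields -/

section Flow

variable {W : Type u} [NormedAddCommGroup W] [NormedSpace ℝ W] [CompleteSpace W]

/-- `Γ` is a smooth local flow of the vector field `f`: for `w ∈ N`, the curve `Γ w` on the unit
interval solves `γ' = s f(γ)`, `γ(0) = w`, stays in `O`, and is constant if `w` is a zero
of `f`. -/
structure IsLocalFlow {f : W → W} (hf : Continuous f) (s : ℝ) (N O : Set W)
    (Γ : W → C(unitInterval, W)) : Prop where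
  isOpen : IsOpen N
  contDiffOn : ContDiffOn ℝ ∞ Γ N
  eq_primitive : ∀ w ∈ N, Γ w = constCurve W w + s • primitive W (superpose unitInterval hf (Γ w))
  mem : ∀ w ∈ N, ∀ τ, Γ w τ ∈ O
  eq_const : ∀ w ∈ N, f w = 0 → Γ w = constCurve W w

/-- Smooth dependence of short-time solutions of an autonomous smooth ODE on the initial value. The
curves on the unit interval with `γ = w + s ∫ f(γ)` are found by the inverse function theorem in
the Banach space of curves; at `s = 0` the linearized equation is trivially solvable. -/
theorem exists_smooth_flow {f : W → W} (hf : ContDiff ℝ ∞ f) (w₀ : W) {O : Set W}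
    (hO : IsOpen O) (hw₀ : w₀ ∈ O) :
    ∃ s > (0 : ℝ), ∃ N : Set W, w₀ ∈ N ∧ ∃ Γ : W → C(unitInterval, W),
      IsLocalFlow hf.continuous s N O Γ := by
  let C := C(unitInterval, W)
  let Nf : C → C := superpose unitInterval hf.continuous
  have hNf : ContDiff ℝ ∞ Nf := contDiff_superpose hf
  let Θ : (W × ℝ) × C → (W × ℝ) × C := fun p =>
    (p.1, p.2 - (constCurve W p.1.1 + p.1.2 • primitive W (Nf p.2)))
  have hΘ : ContDiff ℝ ∞ Θ := by
    have h1 : ContDiff ℝ ∞ fun p : (W × ℝ) × C => primitive W (Nf p.2) :=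
      (primitive W).contDiff.comp (hNf.comp contDiff_snd)
    have h2 : ContDiff ℝ ∞ fun p : (W × ℝ) × C => constCurve W p.1.1 :=
      (constCurve W).contDiff.comp (contDiff_fst.comp contDiff_fst)
    exact contDiff_fst.prodMk (contDiff_snd.sub (h2.add
      ((contDiff_snd.comp contDiff_fst).smul h1)))
  let γ₀ : C := constCurve W w₀
  let a : (W × ℝ) × C := ((w₀, 0), γ₀)
  let L : (W × ℝ) →L[ℝ] C := -((constCurve W).comp (ContinuousLinearMap.fst ℝ W ℝ) +
    (ContinuousLinearMap.snd ℝ W ℝ).smulRight (primitive W (Nf γ₀)))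
  let D : ((W × ℝ) × C) ≃L[ℝ] ((W × ℝ) × C) :=
    (ContinuousLinearEquiv.refl ℝ (W × ℝ)).skewProd (ContinuousLinearEquiv.refl ℝ C) L
  have hD : fderiv ℝ Θ a = D := by
    have h0 : HasFDerivAt (fun γ => primitive W (Nf γ)) ((primitive W).comp (fderiv ℝ Nf γ₀)) γ₀ :=
      ((primitive W).hasFDerivAt).comp γ₀ ((hNf.differentiable (by simp) γ₀).hasFDerivAt)
    have h1 : HasFDerivAt (fun p : (W × ℝ) × C => primitive W (Nf p.2))
        (((primitive W).comp (fderiv ℝ Nf γ₀)).comp (ContinuousLinearMap.snd ℝ _ _)) a :=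
      HasFDerivAt.comp (g := fun γ => primitive W (Nf γ)) a h0 hasFDerivAt_snd
    have h2 : HasFDerivAt (fun p : (W × ℝ) × C => constCurve W p.1.1)
        ((constCurve W).comp ((ContinuousLinearMap.fst ℝ W ℝ).comp
          (ContinuousLinearMap.fst ℝ _ _))) a :=
      ((constCurve W).hasFDerivAt).comp a (hasFDerivAt_fst.comp a hasFDerivAt_fst)
    have h3 : HasFDerivAt (fun p : (W × ℝ) × C => p.1.2)
        ((ContinuousLinearMap.snd ℝ W ℝ).comp (ContinuousLinearMap.fst ℝ _ _)) a :=
      hasFDerivAt_snd.comp a hasFDerivAt_fst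
    have h4 := (hasFDerivAt_fst (p := a)).prodMk
      ((hasFDerivAt_snd (p := a)).sub (h2.add (h3.smul h1)))
    refine (HasFDerivAt.fderiv h4).trans ?_
    refine ContinuousLinearMap.ext fun h => ?_
    refine Prod.ext rfl ?_
    simp [D, L, a, sub_eq_add_neg, ContinuousLinearEquiv.skewProd_apply]
  obtain ⟨e, hae, -, he, hes⟩ := exists_openPartialHomeomorph_contDiffOn_symm isOpen_univ
    hΘ.contDiffOn (mem_univ a) D hD
  have hΘa : e a = ((w₀, 0), 0) := by
    rw [he]; simp [Θ, a, γ₀]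
  have hmem : ((w₀, (0 : ℝ)), (0 : C)) ∈ e.target := hΘa ▸ e.map_source hae
  have hsymm : e.symm ((w₀, 0), 0) = a := by rw [← hΘa, e.left_inv hae]
  -- the admissible data `(w, s)`: the solution exists, stays in `O`, and the constant curve lies in
  -- the domain where solutions are unique
  let U : Set C := {γ | MapsTo γ univ O}
  have hU : IsOpen U := ContinuousMap.isOpen_setOfPred_mapsTo isCompact_univ hO
  let T : Set ((W × ℝ) × C) := e.target ∩ e.symm ⁻¹' (Prod.snd ⁻¹' U)
  have hT : IsOpen T := e.symm.isOpen_inter_preimage (hU.preimage continuous_snd)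
  let Q : Set (W × ℝ) := {p | (p, (0 : C)) ∈ T ∧ (p, constCurve W p.1) ∈ e.source}
  have hQ : IsOpen Q := by
    refine IsOpen.inter (hT.preimage (by fun_prop)) (e.open_source.preimage ?_)
    exact continuous_id.prodMk ((constCurve W).continuous.comp continuous_fst)
  have h0Q : (w₀, (0 : ℝ)) ∈ Q := by
    refine ⟨⟨hmem, ?_⟩, hae⟩
    simp only [mem_preimage, hsymm, a, U, mem_ofPred_eq]
    exact fun τ _ => hw₀
  have hev : ∀ᶠ s : ℝ in 𝓝[>] 0, (w₀, s) ∈ Q := by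
    have hc : ContinuousAt (fun s : ℝ => (w₀, s)) 0 := by fun_prop
    exact (hc.eventually (hQ.mem_nhds h0Q)).filter_mono nhdsWithin_le_nhds
  obtain ⟨s, hsQ, hs⟩ := (hev.and self_mem_nhdsWithin).exists
  refine ⟨s, hs, {w | (w, s) ∈ Q}, hsQ, fun w => (e.symm ((w, s), 0)).2,
    hQ.preimage (by fun_prop), ?_, fun w hw => ?_, fun w hw τ => hw.1.2 (mem_univ τ),
    fun w hw => ?_⟩
  · exact contDiff_snd.comp_contDiffOn (hes.comp (by fun_prop) fun w hw => hw.1.1)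
  · have h1 : Θ (e.symm ((w, s), 0)) = ((w, s), 0) := by rw [← he]; exact e.right_inv hw.1.1
    have h2 : (e.symm ((w, s), 0)).1 = (w, s) := congrArg Prod.fst h1
    have h3 := congrArg Prod.snd h1
    simp only [Θ, h2] at h3
    exact sub_eq_zero.1 h3
  · intro hfw
    have h1 : e ((w, s), constCurve W w) = ((w, s), 0) := by
      rw [he]
      have : Nf (constCurve W w) = 0 := by
        ext τ; exact hfw
      simp [Θ, this]
    change (e.symm ((w, s), 0)).2 = _
    rw [← h1, e.left_inv hw.2]

omit [CompleteSpace W] in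
/-- The derivative of a smooth family of solutions solves the linearized equation. -/
lemma IsLocalFlow.fderiv_eq_primitive {f : W → W} (hf : ContDiff ℝ ∞ f) {s : ℝ} {N O : Set W}
    {Γ : W → C(unitInterval, W)} (hΓ : IsLocalFlow hf.continuous s N O Γ) {w : W} (hw : w ∈ N)
    (h : W) :
    fderiv ℝ Γ w h = constCurve W h + s • primitive W (pointwiseApply unitInterval W W
      (superpose unitInterval (hf.continuous_fderiv (by simp)) (Γ w)) (fderiv ℝ Γ w h)) := by
  have hd : HasFDerivAt Γ (fderiv ℝ Γ w) w :=
    ((hΓ.contDiffOn.contDiffAt (hΓ.isOpen.mem_nhds hw)).differentiableAt (by simp)).hasFDerivAt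
  have h1 := (hasFDerivAt_superpose (fun x => ((hf.differentiable (by simp)) x).hasFDerivAt)
    hf.continuous (hf.continuous_fderiv (by simp)) (Γ w)).comp w hd
  have h2 := ((constCurve W).hasFDerivAt (x := w)).add
    (((primitive W).hasFDerivAt.comp w h1).const_smul s)
  have h3 : HasFDerivAt Γ _ w := h2.congr_of_eventuallyEq (by
    filter_upwards [hΓ.isOpen.mem_nhds hw] with y hy
    exact hΓ.eq_primitive y hy)
  exact congrArg (fun A : W →L[ℝ] C(unitInterval, W) => A h) (hd.unique h3)

omit [CompleteSpace W] in
lemma IsLocalFlow.hasFDerivAt {f : W → W} {hf : Continuous f} {s : ℝ} {N O : Set W}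
    {Γ : W → C(unitInterval, W)} (hΓ : IsLocalFlow hf s N O Γ) {w : W} (hw : w ∈ N) :
    HasFDerivAt Γ (fderiv ℝ Γ w) w :=
  ((hΓ.contDiffOn.contDiffAt (hΓ.isOpen.mem_nhds hw)).differentiableAt (by simp)).hasFDerivAt

omit [CompleteSpace W] in
lemma IsLocalFlow.apply_zero {f : W → W} {hf : Continuous f} {s : ℝ} {N O : Set W}
    {Γ : W → C(unitInterval, W)} (hΓ : IsLocalFlow hf s N O Γ) {w : W} (hw : w ∈ N) :
    Γ w 0 = w := by
  rw [hΓ.eq_primitive w hw]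
  simp [primitive_zero]

lemma IsLocalFlow.hasDerivAt {f : W → W} {hf : Continuous f} {s : ℝ} {N O : Set W}
    {Γ : W → C(unitInterval, W)} (hΓ : IsLocalFlow hf s N O Γ) {w : W} (hw : w ∈ N) {τ : ℝ}
    (hτ : τ ∈ Ioo (0 : ℝ) 1) :
    HasDerivAt (fun r => Γ w (projIcc 0 1 zero_le_one r))
      (s • f (Γ w (projIcc 0 1 zero_le_one τ))) τ :=
  hasDerivAt_of_eq_primitive (hΓ.eq_primitive w hw) hτ

lemma IsLocalFlow.hasDerivAt_fderiv {f : W → W} (hf : ContDiff ℝ ∞ f) {s : ℝ} {N O : Set W}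
    {Γ : W → C(unitInterval, W)} (hΓ : IsLocalFlow hf.continuous s N O Γ) {w : W} (hw : w ∈ N)
    (h : W) {τ : ℝ} (hτ : τ ∈ Ioo (0 : ℝ) 1) :
    HasDerivAt (fun r => fderiv ℝ Γ w h (projIcc 0 1 zero_le_one r))
      (s • fderiv ℝ f (Γ w (projIcc 0 1 zero_le_one τ))
        (fderiv ℝ Γ w h (projIcc 0 1 zero_le_one τ))) τ :=
  hasDerivAt_of_eq_primitive (hΓ.fderiv_eq_primitive hf hw h) hτ

omit [CompleteSpace W] in
lemma IsLocalFlow.fderiv_apply_zero {f : W → W} (hf : ContDiff ℝ ∞ f) {s : ℝ} {N O : Set W}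
    {Γ : W → C(unitInterval, W)} (hΓ : IsLocalFlow hf.continuous s N O Γ) {w : W} (hw : w ∈ N)
    (h : W) : fderiv ℝ Γ w h 0 = h := by
  rw [hΓ.fderiv_eq_primitive hf hw h]
  simp [primitive_zero]

omit [CompleteSpace W] in
lemma IsLocalFlow.hasFDerivAt_apply {f : W → W} {hf : Continuous f} {s : ℝ} {N O : Set W}
    {Γ : W → C(unitInterval, W)} (hΓ : IsLocalFlow hf s N O Γ) {w : W} (hw : w ∈ N)
    (τ : unitInterval) :
    HasFDerivAt (fun w => Γ w τ) ((ContinuousMap.evalCLM ℝ τ).comp (fderiv ℝ Γ w)) w :=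
  (ContinuousMap.evalCLM ℝ τ : C(unitInterval, W) →L[ℝ] W).hasFDerivAt.comp w (hΓ.hasFDerivAt hw)

end Flow

/-! ### Hadamard's lemma -/

section Hadamard

/-- Hadamard's lemma with parameters. -/
lemma exists_contDiff_eq_add_mul {A : Type} [NormedAddCommGroup A] [NormedSpace ℝ A]
    {q : A × ℝ → ℝ} (hq : ContDiff ℝ ∞ q) :
    ∃ Q : A × ℝ → ℝ, ContDiff ℝ ∞ Q ∧ (∀ a ε, q (a, ε) = q (a, 0) + ε * Q (a, ε)) ∧
      ∀ a, Q (a, 0) = fderiv ℝ q (a, 0) (0, 1) := by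
  let ψ : A × ℝ → ℝ := fun p => fderiv ℝ q p (0, 1)
  have hψ : ContDiff ℝ ∞ ψ := (hq.fderiv_right (by simp)).clm_apply contDiff_const
  let idc : C(unitInterval, A × ℝ) := ⟨fun r => (0, (r : ℝ)), by fun_prop⟩
  let ℓ : (A × ℝ) →L[ℝ] C(unitInterval, A × ℝ) :=
    (constCurve (A × ℝ)).comp ((ContinuousLinearMap.inl ℝ A ℝ).comp
      (ContinuousLinearMap.fst ℝ A ℝ)) + (ContinuousLinearMap.snd ℝ A ℝ).smulRight idc
  have hℓ : ∀ a ε τ, ℓ (a, ε) τ = (a, ε * τ) := by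
    intro a ε τ
    simp [ℓ, idc]
  let ev : C(unitInterval, ℝ) →L[ℝ] ℝ := ContinuousMap.evalCLM ℝ 1
  -- the quotient is the integral over `r` in `[0, 1]` of the partial derivative at `(a, ε r)`
  refine ⟨fun p => ev (primitive ℝ (superpose unitInterval hψ.continuous (ℓ p))), ?_, ?_, ?_⟩
  · exact ev.contDiff.comp ((primitive ℝ).contDiff.comp ((contDiff_superpose hψ).comp ℓ.contDiff))
  · intro a ε
    have hd : ∀ r ∈ uIcc (0 : ℝ) 1, HasDerivAt (fun r : ℝ => q (a, ε * r)) (ε * ψ (a, ε * r)) r := by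
      intro r _
      have h1 : HasDerivAt (fun r : ℝ => (a, ε * r)) ((0 : A), ε) r := by
        simpa using (hasDerivAt_const r a).prodMk ((hasDerivAt_id r).const_mul ε)
      have h2 := ((hq.differentiable (by simp) (a, ε * r)).hasFDerivAt).comp_hasDerivAt r h1
      refine h2.congr_deriv ?_
      have : ((0 : A), ε) = ε • ((0 : A), (1 : ℝ)) := by simp
      rw [this, map_smul, smul_eq_mul]
    have hcont : Continuous fun r : ℝ => ε * ψ (a, ε * r) :=
      continuous_const.mul (hψ.continuous.comp (by fun_prop))
    have hint := intervalIntegral.integral_eq_sub_of_hasDerivAt hd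
      (hcont.intervalIntegrable 0 1)
    rw [intervalIntegral.integral_const_mul] at hint
    have : ev (primitive ℝ (superpose unitInterval hψ.continuous (ℓ (a, ε)))) =
        ∫ r in (0 : ℝ)..1, ψ (a, ε * r) := by
      change ∫ r in (0 : ℝ)..((1 : unitInterval) : ℝ), _ = _
      refine intervalIntegral.integral_congr fun r hr => ?_
      have hr' : r ∈ Icc (0 : ℝ) 1 := by simpa using hr
      simp [hℓ, projIcc_of_mem zero_le_one hr']
    simp only [this, hint]
    simp
  · intro a
    change ∫ r in (0 : ℝ)..((1 : unitInterval) : ℝ), _ = _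
    simp [hℓ, ψ]

end Hadamard

/-! ### Curves with equal derivatives -/

lemma eq_on_unitInterval_of_hasDerivAt {u v d : ℝ → ℝ} (hu : Continuous u)
    (hv : Continuous v) (hu' : ∀ τ ∈ Ioo (0 : ℝ) 1, HasDerivAt u (d τ) τ)
    (hv' : ∀ τ ∈ Ioo (0 : ℝ) 1, HasDerivAt v (d τ) τ) (h0 : u 0 = v 0) {τ : ℝ}
    (hτ : τ ∈ Icc (0 : ℝ) 1) : u τ = v τ := by
  rcases hτ.1.eq_or_lt with rfl | h
  · exact h0
  · obtain ⟨c, hc, hc'⟩ := exists_hasDerivAt_eq_slope (fun r => u r - v r) (fun r => d r - d r) h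
      (hu.sub hv).continuousOn fun r hr => (hu' r ⟨hr.1, hr.2.trans_le hτ.2⟩).sub
        (hv' r ⟨hr.1, hr.2.trans_le hτ.2⟩)
    rw [sub_self, eq_comm, div_eq_zero_iff] at hc'
    rcases hc' with hc' | hc' <;> linarith

/-- Two continuous curves with the same derivative and the same initial value coincide. -/
lemma eq_on_unitInterval_of_hasDerivAt' {Y : Type*} [NormedAddCommGroup Y] [NormedSpace ℝ Y]
    {u v d : ℝ → Y} (hu : Continuous u) (hv : Continuous v)
    (hu' : ∀ τ ∈ Ioo (0 : ℝ) 1, HasDerivAt u (d τ) τ)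
    (hv' : ∀ τ ∈ Ioo (0 : ℝ) 1, HasDerivAt v (d τ) τ) (h0 : u 0 = v 0) {τ : ℝ}
    (hτ : τ ∈ Icc (0 : ℝ) 1) : u τ = v τ := by
  refine (SeparatingDual.eq_iff_forall_dual_eq (R := ℝ)).2 fun g => ?_
  exact eq_on_unitInterval_of_hasDerivAt (u := fun r => g (u r)) (v := fun r => g (v r))
    (d := fun r => g (d r)) (g.continuous.comp hu) (g.continuous.comp hv)
    (fun r hr => g.hasFDerivAt.comp_hasDerivAt r (hu' r hr))
    (fun r hr => g.hasFDerivAt.comp_hasDerivAt r (hv' r hr)) (congrArg g h0) hτ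

/-! ### Newtonian motion with a variable coupling constant -/

section Newton

variable {V : Type} [NormedAddCommGroup V] [NormedSpace ℝ V]

/-- The phase space of Newtonian motion with a variable coupling constant: position, momentum and
coupling constant. -/
abbrev PhaseSpace (V : Type) [NormedAddCommGroup V] [NormedSpace ℝ V] : Type :=
  V × (V →L[ℝ] ℝ) × ℝ

/-- The Hamiltonian vector field of `½ ξ(B_z ξ) - ½ κ P(z)` in the variables `(z, ξ)`, where `B` is
the inverse of a Riemannian metric and the coupling constant `κ` is a conserved additional
variable. -/
noncomputable def newtonField (B : V → (V →L[ℝ] ℝ) →L[ℝ] V) (P : V → ℝ) (w : PhaseSpace V) :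
    PhaseSpace V :=
  (B w.1 w.2.1,
    -(1 / 2 : ℝ) • w.2.1.comp ((fderiv ℝ B w.1).flip w.2.1) + (w.2.2 / 2) • fderiv ℝ P w.1, 0)

/-- Twice the Hamiltonian of Newtonian motion. -/
noncomputable def newtonEnergy (B : V → (V →L[ℝ] ℝ) →L[ℝ] V) (P : V → ℝ) (w : PhaseSpace V) : ℝ :=
  w.2.1 (B w.1 w.2.1) - w.2.2 * P w.1

variable {B : V → (V →L[ℝ] ℝ) →L[ℝ] V} {P : V → ℝ}

lemma contDiff_clm_flip {X A C D : Type*} [NormedAddCommGroup X] [NormedSpace ℝ X]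
    [NormedAddCommGroup A] [NormedSpace ℝ A] [NormedAddCommGroup C] [NormedSpace ℝ C]
    [NormedAddCommGroup D] [NormedSpace ℝ D] {f : X → A →L[ℝ] C →L[ℝ] D} (hf : ContDiff ℝ ∞ f) :
    ContDiff ℝ ∞ fun x => (f x).flip := by
  have h : IsBoundedLinearMap ℝ fun L : A →L[ℝ] C →L[ℝ] D => L.flip :=
    { map_add := fun _ _ => rfl
      map_smul := fun _ _ => rfl
      bound := ⟨1, one_pos, fun L => by rw [L.opNorm_flip, one_mul]⟩ }
  exact h.contDiff.comp hf

lemma contDiff_newtonField (hB : ContDiff ℝ ∞ B) (hP : ContDiff ℝ ∞ P) :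
    ContDiff ℝ ∞ (newtonField B P) := by
  have hB' : ContDiff ℝ ∞ (fderiv ℝ B) := hB.fderiv_right (by simp)
  have hP' : ContDiff ℝ ∞ (fderiv ℝ P) := hP.fderiv_right (by simp)
  have h1 : ContDiff ℝ ∞ fun w : PhaseSpace V => w.1 := contDiff_fst
  have h2 : ContDiff ℝ ∞ fun w : PhaseSpace V => w.2.1 := contDiff_fst.comp contDiff_snd
  have h3 : ContDiff ℝ ∞ fun w : PhaseSpace V => w.2.2 := contDiff_snd.comp contDiff_snd
  have h4 : ContDiff ℝ ∞ fun w : PhaseSpace V => (fderiv ℝ B w.1).flip :=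
    contDiff_clm_flip (hB'.comp h1)
  have h5 : ContDiff ℝ ∞ fun w : PhaseSpace V =>
      w.2.1.comp ((fderiv ℝ B w.1).flip w.2.1) :=
    h2.clm_comp (h4.clm_apply h2)
  have h6 : ContDiff ℝ ∞ fun w : PhaseSpace V => (w.2.2 / 2) • fderiv ℝ P w.1 :=
    (h3.div_const 2).smul (hP'.comp h1)
  have h7 : ContDiff ℝ ∞ fun w : PhaseSpace V =>
      -(1 / 2 : ℝ) • w.2.1.comp ((fderiv ℝ B w.1).flip w.2.1) +
        (w.2.2 / 2) • fderiv ℝ P w.1 := (h5.const_smul _).add h6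
  exact ((hB.comp h1).clm_apply h2).prodMk
    (h7.prodMk contDiff_const)

lemma contDiff_newtonEnergy (hB : ContDiff ℝ ∞ B) (hP : ContDiff ℝ ∞ P) :
    ContDiff ℝ ∞ (newtonEnergy B P) := by
  have h1 : ContDiff ℝ ∞ fun w : PhaseSpace V => w.1 := contDiff_fst
  have h2 : ContDiff ℝ ∞ fun w : PhaseSpace V => w.2.1 := contDiff_fst.comp contDiff_snd
  have h3 : ContDiff ℝ ∞ fun w : PhaseSpace V => w.2.2 := contDiff_snd.comp contDiff_snd
  exact (h2.clm_apply ((hB.comp h1).clm_apply h2)).sub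
    (h3.mul (hP.comp h1))

lemma fderiv_newtonEnergy_apply (hB : ContDiff ℝ ∞ B) (hP : ContDiff ℝ ∞ P) (w h : PhaseSpace V) :
    fderiv ℝ (newtonEnergy B P) w h =
      h.2.1 (B w.1 w.2.1) + w.2.1 (fderiv ℝ B w.1 h.1 w.2.1) + w.2.1 (B w.1 h.2.1) -
        h.2.2 * P w.1 - w.2.2 * fderiv ℝ P w.1 h.1 := by
  have h1 : HasFDerivAt (fun w : PhaseSpace V => w.1) (ContinuousLinearMap.fst ℝ _ _) w :=
    hasFDerivAt_fst
  have h2 : HasFDerivAt (fun w : PhaseSpace V => w.2.1)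
      ((ContinuousLinearMap.fst ℝ _ _).comp (ContinuousLinearMap.snd ℝ _ _)) w :=
    hasFDerivAt_fst.comp w hasFDerivAt_snd
  have h3 : HasFDerivAt (fun w : PhaseSpace V => w.2.2)
      ((ContinuousLinearMap.snd ℝ _ _).comp (ContinuousLinearMap.snd ℝ _ _)) w :=
    hasFDerivAt_snd.comp w hasFDerivAt_snd
  have hB1 : HasFDerivAt (fun w : PhaseSpace V => B w.1) _ w :=
    ((hB.differentiable (by simp) w.1).hasFDerivAt).comp w h1
  have hP1 : HasFDerivAt (fun w : PhaseSpace V => P w.1) _ w :=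
    ((hP.differentiable (by simp) w.1).hasFDerivAt).comp w h1
  have := (h2.clm_apply (hB1.clm_apply h2)).sub (h3.mul hP1)
  rw [HasFDerivAt.fderiv (f := newtonEnergy B P) this]
  simp
  ring

lemma fderiv_newtonField_apply_fst (hB : ContDiff ℝ ∞ B) (hP : ContDiff ℝ ∞ P)
    (w h : PhaseSpace V) :
    (fderiv ℝ (newtonField B P) w h).1 = fderiv ℝ B w.1 h.1 w.2.1 + B w.1 h.2.1 := by
  have h1 : HasFDerivAt (fun w : PhaseSpace V => w.1) (ContinuousLinearMap.fst ℝ _ _) w :=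
    hasFDerivAt_fst
  have h2 : HasFDerivAt (fun w : PhaseSpace V => w.2.1)
      ((ContinuousLinearMap.fst ℝ _ _).comp (ContinuousLinearMap.snd ℝ _ _)) w :=
    hasFDerivAt_fst.comp w hasFDerivAt_snd
  have hB1 : HasFDerivAt (fun w : PhaseSpace V => B w.1) _ w :=
    ((hB.differentiable (by simp) w.1).hasFDerivAt).comp w h1
  have h3 := hB1.clm_apply h2
  have h4 := (((contDiff_newtonField hB hP).differentiable (by simp) w).hasFDerivAt).fst
  have h5 := h4.unique h3
  have h6 := congrArg (fun A : PhaseSpace V →L[ℝ] V => A h) h5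
  simp at h6
  rw [h6, add_comm]

lemma newtonField_eq_zero (z : V) : newtonField B P (z, 0, 0) = 0 := by
  simp [newtonField]

lemma fderiv_newtonField_zero_apply_snd_fst (hB : ContDiff ℝ ∞ B) (hP : ContDiff ℝ ∞ P) (z : V)
    (h : PhaseSpace V) :
    (fderiv ℝ (newtonField B P) (z, 0, 0) h).2.1 = (h.2.2 / 2) • fderiv ℝ P z := by
  have hB' : ContDiff ℝ ∞ (fderiv ℝ B) := hB.fderiv_right (by simp)
  have hP' : ContDiff ℝ ∞ (fderiv ℝ P) := hP.fderiv_right (by simp)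
  let w : PhaseSpace V := (z, 0, 0)
  have h2 : HasFDerivAt (fun w : PhaseSpace V => w.2.1)
      ((ContinuousLinearMap.fst ℝ _ _).comp (ContinuousLinearMap.snd ℝ _ _)) w :=
    hasFDerivAt_fst.comp w hasFDerivAt_snd
  have h3 : HasFDerivAt (fun w : PhaseSpace V => w.2.2 / 2)
      ((1 / 2 : ℝ) • ((ContinuousLinearMap.snd ℝ _ _).comp (ContinuousLinearMap.snd ℝ _ _))) w := by
    simpa [div_eq_inv_mul] using (hasFDerivAt_snd.comp w hasFDerivAt_snd).const_mul (1 / 2 : ℝ)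
  have h4 : HasFDerivAt (fun w : PhaseSpace V => (fderiv ℝ B w.1).flip w.2.1)
      (fderiv ℝ (fun w : PhaseSpace V => (fderiv ℝ B w.1).flip w.2.1) w) w :=
    (((contDiff_clm_flip (hB'.comp (contDiff_fst (E := V) (F := (V →L[ℝ] ℝ) × ℝ)))).clm_apply
      (contDiff_fst.comp contDiff_snd)).differentiable (by simp) w).hasFDerivAt
  have h5 : HasFDerivAt (fun w : PhaseSpace V => fderiv ℝ P w.1) _ w :=
    ((hP'.differentiable (by simp) z).hasFDerivAt).comp w hasFDerivAt_fst
  have h6 := ((h2.clm_comp h4).const_smul (-(1 / 2) : ℝ)).add (h3.smul h5)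
  have h7 := ((((contDiff_newtonField hB hP).differentiable (by simp) w).hasFDerivAt).snd).fst
  have h8 := congrArg (fun A : PhaseSpace V →L[ℝ] (V →L[ℝ] ℝ) => A h) (h7.unique h6)
  simp [w] at h8
  rw [h8, div_eq_inv_mul]

end Newton

/-! ### Conservation laws and the first variation formula -/

section Gauss

variable {V : Type} [NormedAddCommGroup V] [NormedSpace ℝ V] [CompleteSpace V]
  {B : V → (V →L[ℝ] ℝ) →L[ℝ] V} {P : V → ℝ} {s : ℝ} {N : Set (PhaseSpace V)} {O : Set V}
  {Γ : PhaseSpace V → C(unitInterval, PhaseSpace V)}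

lemma flow_coupling_eq (hB : ContDiff ℝ ∞ B) (hP : ContDiff ℝ ∞ P)
    (hΓ : IsLocalFlow (contDiff_newtonField hB hP).continuous s N (Prod.fst ⁻¹' O) Γ)
    {w : PhaseSpace V} (hw : w ∈ N) (τ : unitInterval) : (Γ w τ).2.2 = w.2.2 := by
  have h := eq_on_unitInterval_of_hasDerivAt
    (u := fun r => (Γ w (projIcc 0 1 zero_le_one r)).2.2) (v := fun _ => w.2.2) (d := fun _ => 0)
    (by fun_prop) continuous_const
    (fun r hr => by
      have h1 : HasDerivAt (fun r => (Γ w (projIcc 0 1 zero_le_one r)).2.2) _ r :=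
        (hasFDerivAt_snd.comp _ hasFDerivAt_snd).comp_hasDerivAt r (hΓ.hasDerivAt hw hr)
      exact h1.congr_deriv (by simp [newtonField]))
    (fun r _ => hasDerivAt_const r _)
    (by simp [hΓ.apply_zero hw]) τ.2
  simpa using h

lemma fderiv_flow_coupling_eq (hB : ContDiff ℝ ∞ B) (hP : ContDiff ℝ ∞ P)
    (hΓ : IsLocalFlow (contDiff_newtonField hB hP).continuous s N (Prod.fst ⁻¹' O) Γ)
    {w : PhaseSpace V} (hw : w ∈ N) (h : PhaseSpace V) (τ : unitInterval) :
    (fderiv ℝ Γ w h τ).2.2 = h.2.2 := by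
  have h1 := ((hΓ.hasFDerivAt_apply hw τ).snd).snd
  have h2 : HasFDerivAt (fun w => (Γ w τ).2.2) ((ContinuousLinearMap.snd ℝ _ _).comp
      (ContinuousLinearMap.snd ℝ V ((V →L[ℝ] ℝ) × ℝ))) w := by
    refine (hasFDerivAt_snd.comp w hasFDerivAt_snd).congr_of_eventuallyEq ?_
    filter_upwards [hΓ.isOpen.mem_nhds hw] with y hy
    exact flow_coupling_eq hB hP hΓ hy τ
  exact congrArg (fun A : PhaseSpace V →L[ℝ] ℝ => A h) (h1.unique h2)

/-- Conservation of energy. -/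
lemma newtonEnergy_flow_eq (hB : ContDiff ℝ ∞ B) (hP : ContDiff ℝ ∞ P)
    (hsym : ∀ z ∈ O, ∀ ξ ζ : V →L[ℝ] ℝ, ζ (B z ξ) = ξ (B z ζ))
    (hΓ : IsLocalFlow (contDiff_newtonField hB hP).continuous s N (Prod.fst ⁻¹' O) Γ)
    {w : PhaseSpace V} (hw : w ∈ N) (τ : unitInterval) :
    newtonEnergy B P (Γ w τ) = newtonEnergy B P w := by
  have hE := contDiff_newtonEnergy hB hP
  have h := eq_on_unitInterval_of_hasDerivAt
    (u := fun r => newtonEnergy B P (Γ w (projIcc 0 1 zero_le_one r)))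
    (v := fun _ => newtonEnergy B P w) (d := fun _ => 0)
    (hE.continuous.comp (by fun_prop)) continuous_const
    (fun r hr => by
      have h1 := ((hE.differentiable (by simp) _).hasFDerivAt).comp_hasDerivAt r
        (hΓ.hasDerivAt hw hr)
      refine h1.congr_deriv ?_
      have hs := hsym _ (hΓ.mem w hw (projIcc 0 1 zero_le_one r))
      generalize Γ w (projIcc 0 1 zero_le_one r) = y at hs
      rw [fderiv_newtonEnergy_apply hB hP, hs (s • newtonField B P y).2.1 y.2.1]
      simp [newtonField]
      ring)
    (fun r _ => hasDerivAt_const r _)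
    (by simp [hΓ.apply_zero hw]) τ.2
  simpa using h

lemma fderiv_newtonEnergy_flow_eq (hB : ContDiff ℝ ∞ B) (hP : ContDiff ℝ ∞ P)
    (hsym : ∀ z ∈ O, ∀ ξ ζ : V →L[ℝ] ℝ, ζ (B z ξ) = ξ (B z ζ))
    (hΓ : IsLocalFlow (contDiff_newtonField hB hP).continuous s N (Prod.fst ⁻¹' O) Γ)
    {w : PhaseSpace V} (hw : w ∈ N) (h : PhaseSpace V) (τ : unitInterval) :
    fderiv ℝ (newtonEnergy B P) (Γ w τ) (fderiv ℝ Γ w h τ) = fderiv ℝ (newtonEnergy B P) w h := by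
  have hE := (contDiff_newtonEnergy hB hP).differentiable (by simp)
  have h1 := ((hE (Γ w τ)).hasFDerivAt).comp w (hΓ.hasFDerivAt_apply hw τ)
  have h2 : HasFDerivAt (fun w => newtonEnergy B P (Γ w τ)) (fderiv ℝ (newtonEnergy B P) w) w := by
    refine ((hE w).hasFDerivAt).congr_of_eventuallyEq ?_
    filter_upwards [hΓ.isOpen.mem_nhds hw] with y hy
    exact newtonEnergy_flow_eq hB hP hsym hΓ hy τ
  exact congrArg (fun A : PhaseSpace V →L[ℝ] ℝ => A h) (h1.unique h2)

omit [CompleteSpace V] in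
lemma contDiff_comp_fst (hP : ContDiff ℝ ∞ P) : ContDiff ℝ ∞ fun w : PhaseSpace V => P w.1 :=
  hP.comp contDiff_fst

/-- The integral of the potential along the trajectory starting at a point of phase space. -/
noncomputable def potentialIntegral (hP : ContDiff ℝ ∞ P)
    (Γ : PhaseSpace V → C(unitInterval, PhaseSpace V)) (w : PhaseSpace V) : ℝ :=
  primitive ℝ (superpose unitInterval (contDiff_comp_fst hP).continuous (Γ w)) 1

omit [CompleteSpace V] in
lemma potentialIntegral_eq (hP : ContDiff ℝ ∞ P) (w : PhaseSpace V) :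
    potentialIntegral hP Γ w = ∫ r in (0 : ℝ)..1, P (Γ w (projIcc 0 1 zero_le_one r)).1 := rfl

omit [CompleteSpace V] in
lemma contDiffOn_potentialIntegral (hP : ContDiff ℝ ∞ P) (hΓ : ContDiffOn ℝ ∞ Γ N) :
    ContDiffOn ℝ ∞ (potentialIntegral hP Γ) N :=
  (ContinuousMap.evalCLM ℝ 1 : C(unitInterval, ℝ) →L[ℝ] ℝ).contDiff.comp_contDiffOn
    ((primitive ℝ).contDiff.comp_contDiffOn ((contDiff_superpose (contDiff_comp_fst hP)).comp_contDiffOn hΓ))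

omit [CompleteSpace V] in
lemma fderiv_potentialIntegral_apply (hP : ContDiff ℝ ∞ P) (hN : IsOpen N)
    (hΓ : ContDiffOn ℝ ∞ Γ N) {w : PhaseSpace V} (hw : w ∈ N) (h : PhaseSpace V) :
    fderiv ℝ (potentialIntegral hP Γ) w h = ∫ r in (0 : ℝ)..1,
      fderiv ℝ P (Γ w (projIcc 0 1 zero_le_one r)).1
        (fderiv ℝ Γ w h (projIcc 0 1 zero_le_one r)).1 := by
  have hc := contDiff_comp_fst (V := V) hP
  have h0 : HasFDerivAt Γ (fderiv ℝ Γ w) w :=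
    ((hΓ.contDiffAt (hN.mem_nhds hw)).differentiableAt (by simp)).hasFDerivAt
  have hd : ∀ x : PhaseSpace V, HasFDerivAt (fun w : PhaseSpace V => P w.1)
      ((fderiv ℝ P x.1).comp (ContinuousLinearMap.fst ℝ _ _)) x := fun x =>
    ((hP.differentiable (by simp) x.1).hasFDerivAt).comp x hasFDerivAt_fst
  have hd' : Continuous fun x : PhaseSpace V =>
      (fderiv ℝ P x.1).comp (ContinuousLinearMap.fst ℝ V ((V →L[ℝ] ℝ) × ℝ)) :=
    (((hP.continuous_fderiv (by simp)).comp continuous_fst).clm_comp continuous_const)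
  have h1 := (hasFDerivAt_superpose hd hc.continuous hd' (Γ w)).comp w h0
  have h2 := ((ContinuousMap.evalCLM ℝ 1 : C(unitInterval, ℝ) →L[ℝ] ℝ).hasFDerivAt.comp _
    ((primitive ℝ).hasFDerivAt)).comp w h1
  rw [HasFDerivAt.fderiv (f := potentialIntegral hP Γ) h2]
  rfl

/-- The Gauss lemma, in the form of the first variation formula for Newtonian motion: the momentum
at the end point of a trajectory, applied to the variation of the end point, is determined by the
initial momentum and by the variations of the potential integral, of the coupling constant and of
the energy. -/
theorem momentum_apply_fderiv_flow (hB : ContDiff ℝ ∞ B) (hP : ContDiff ℝ ∞ P)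
    (hsym : ∀ z ∈ O, ∀ ξ ζ : V →L[ℝ] ℝ, ζ (B z ξ) = ξ (B z ζ))
    (hΓ : IsLocalFlow (contDiff_newtonField hB hP).continuous s N (Prod.fst ⁻¹' O) Γ)
    {w : PhaseSpace V} (hw : w ∈ N) (h : PhaseSpace V) :
    (Γ w 1).2.1 (fderiv ℝ Γ w h 1).1 = w.2.1 h.1 + s * (1 / 2 * h.2.2 * potentialIntegral hP Γ w +
      w.2.2 * fderiv ℝ (potentialIntegral hP Γ) w h +
      1 / 2 * fderiv ℝ (newtonEnergy B P) w h) := by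
  have hc1 : Continuous fun r : ℝ => P (Γ w (projIcc 0 1 zero_le_one r)).1 :=
    hP.continuous.comp (by fun_prop)
  have hc2 : Continuous fun r : ℝ => fderiv ℝ P (Γ w (projIcc 0 1 zero_le_one r)).1
        (fderiv ℝ Γ w h (projIcc 0 1 zero_le_one r)).1 :=
    ((hP.continuous_fderiv (by simp)).comp (by fun_prop)).clm_apply (by fun_prop)
  have key := eq_on_unitInterval_of_hasDerivAt
    (u := fun r => (Γ w (projIcc 0 1 zero_le_one r)).2.1
      (fderiv ℝ Γ w h (projIcc 0 1 zero_le_one r)).1)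
    (v := fun τ => w.2.1 h.1 + s * (1 / 2 * h.2.2 *
        (∫ r in (0 : ℝ)..τ, P (Γ w (projIcc 0 1 zero_le_one r)).1) +
      w.2.2 * (∫ r in (0 : ℝ)..τ, fderiv ℝ P (Γ w (projIcc 0 1 zero_le_one r)).1
        (fderiv ℝ Γ w h (projIcc 0 1 zero_le_one r)).1) +
      1 / 2 * fderiv ℝ (newtonEnergy B P) w h * τ))
    (d := fun τ => s * (1 / 2 * h.2.2 * P (Γ w (projIcc 0 1 zero_le_one τ)).1 +
      w.2.2 * fderiv ℝ P (Γ w (projIcc 0 1 zero_le_one τ)).1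
        (fderiv ℝ Γ w h (projIcc 0 1 zero_le_one τ)).1 +
      1 / 2 * fderiv ℝ (newtonEnergy B P) w h)) ?_ ?_ ?_ ?_ ?_ (right_mem_Icc.2 zero_le_one)
  · rw [potentialIntegral_eq, fderiv_potentialIntegral_apply hP hΓ.isOpen hΓ.contDiffOn hw]
    simpa using key
  · exact Continuous.clm_apply (by fun_prop) (by fun_prop)
  · refine continuous_const.add (continuous_const.mul (((continuous_const.mul ?_).add
      (continuous_const.mul ?_)).add (continuous_const.mul continuous_id)))
    · exact intervalIntegral.continuous_primitive (fun a b => hc1.intervalIntegrable a b) 0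
    · exact intervalIntegral.continuous_primitive (fun a b => hc2.intervalIntegrable a b) 0
  · intro τ hτ
    have h1 : HasDerivAt (fun r => (Γ w (projIcc 0 1 zero_le_one r)).2.1) _ τ :=
      (hasFDerivAt_fst.comp _ hasFDerivAt_snd).comp_hasDerivAt τ (hΓ.hasDerivAt hw hτ)
    have h2 : HasDerivAt (fun r => (fderiv ℝ Γ w h (projIcc 0 1 zero_le_one r)).1) _ τ :=
      hasFDerivAt_fst.comp_hasDerivAt τ
        (hΓ.hasDerivAt_fderiv (contDiff_newtonField hB hP) hw h hτ)
    refine (h1.clm_apply h2).congr_deriv ?_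
    have hs := hsym _ (hΓ.mem w hw (projIcc 0 1 zero_le_one τ))
    rw [← fderiv_newtonEnergy_flow_eq hB hP hsym hΓ hw h (projIcc 0 1 zero_le_one τ),
      fderiv_newtonEnergy_apply hB hP,
      fderiv_flow_coupling_eq hB hP hΓ hw h, flow_coupling_eq hB hP hΓ hw]
    simp only [ContinuousLinearMap.comp_apply, ContinuousLinearMap.coe_fst',
      ContinuousLinearMap.coe_snd', Prod.smul_fst, Prod.smul_snd, fderiv_newtonField_apply_fst hB hP]
    have hκ := flow_coupling_eq hB hP hΓ hw (projIcc 0 1 zero_le_one τ)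
    generalize Γ w (projIcc 0 1 zero_le_one τ) = y at hs hκ
    generalize fderiv ℝ Γ w h (projIcc 0 1 zero_le_one τ) = δ
    rw [hs y.2.1 δ.2.1]
    simp [newtonField, hκ]
    ring
  · intro τ hτ
    have hp : ∀ {F : ℝ → ℝ}, Continuous F → HasDerivAt (fun τ => ∫ r in (0 : ℝ)..τ, F r) (F τ) τ :=
      fun {F} hF => intervalIntegral.integral_hasDerivAt_right (hF.intervalIntegrable 0 τ)
        hF.aestronglyMeasurable.stronglyMeasurableAtFilter hF.continuousAt
    refine (((((hp hc1).const_mul (1 / 2 * h.2.2)).add ((hp hc2).const_mul w.2.2)).add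
      ((hasDerivAt_id τ).const_mul (1 / 2 * fderiv ℝ (newtonEnergy B P) w h))).const_mul
        s |>.const_add (w.2.1 h.1)).congr_deriv ?_
    simp
  · simp [hΓ.apply_zero hw, hΓ.fderiv_apply_zero (contDiff_newtonField hB hP) hw]

end Gauss

/-! ### Solutions of the eikonal equation -/

section Eikonal

/-- `T` is, on `O`, a candidate for the squared distance to `Z` with respect to the squared length
`q` of vectors: it vanishes exactly on `Z`, `√T` does not increase faster than length, and every
point of `O` is joined to `Z` by a `C¹` curve in `Ω` of length `√T`. -/
structure IsEikonalSquare {V : Type} [NormedAddCommGroup V] [NormedSpace ℝ V]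
    (q : V → V → ℝ) (Z O Ω : Set V) (T : V → ℝ) : Prop where
  contDiffOn : ContDiffOn ℝ ∞ T O
  nonneg : ∀ z ∈ O, 0 ≤ T z
  eq_zero_iff : ∀ z ∈ O, T z = 0 ↔ z ∈ Z
  sq_fderiv_le : ∀ z ∈ O, ∀ v, (fderiv ℝ T z v) ^ 2 ≤ 4 * T z * q z v
  exists_curve : ∀ z ∈ O, ∃ c : ℝ → V, ContDiff ℝ 1 c ∧ c 0 ∈ Z ∧ c 1 = z ∧
    (∀ τ ∈ Icc (0 : ℝ) 1, c τ ∈ Ω) ∧ ∃ ℓ : ℝ → ℝ, Continuous ℓ ∧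
      (∀ τ ∈ Icc (0 : ℝ) 1, 0 ≤ ℓ τ ∧ q (c τ) (deriv c τ) = ℓ τ ^ 2) ∧
      ∫ τ in (0 : ℝ)..1, ℓ τ = √(T z)

lemma IsEikonalSquare.congr {V : Type} [NormedAddCommGroup V] [NormedSpace ℝ V]
    {q q' : V → V → ℝ} {Z O Ω : Set V} {T : V → ℝ} (h : IsEikonalSquare q Z O Ω T)
    (hO : O ⊆ Ω) (hq : ∀ z ∈ Ω, ∀ v, q z v = q' z v) : IsEikonalSquare q' Z O Ω T where
  contDiffOn := h.contDiffOn
  nonneg := h.nonneg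
  eq_zero_iff := h.eq_zero_iff
  sq_fderiv_le z hz v := hq z (hO hz) v ▸ h.sq_fderiv_le z hz v
  exists_curve z hz := by
    obtain ⟨c, hc, h0, h1, hc', ℓ, hℓ, hℓ', hint⟩ := h.exists_curve z hz
    exact ⟨c, hc, h0, h1, hc', ℓ, hℓ, fun τ hτ =>
      ⟨(hℓ' τ hτ).1, hq _ (hc' τ hτ) _ ▸ (hℓ' τ hτ).2⟩, hint⟩

lemma IsEikonalSquare.mono {V : Type} [NormedAddCommGroup V] [NormedSpace ℝ V]
    {q : V → V → ℝ} {Z O O' Ω Ω' : Set V} {T : V → ℝ} (h : IsEikonalSquare q Z O Ω T)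
    (hO : O' ⊆ O) (hΩ : Ω ⊆ Ω') : IsEikonalSquare q Z O' Ω' T where
  contDiffOn := h.contDiffOn.mono hO
  nonneg z hz := h.nonneg z (hO hz)
  eq_zero_iff z hz := h.eq_zero_iff z (hO hz)
  sq_fderiv_le z hz := h.sq_fderiv_le z (hO hz)
  exists_curve z hz := by
    obtain ⟨c, hc, h0, h1, hc', hℓ⟩ := h.exists_curve z (hO hz)
    exact ⟨c, hc, h0, h1, fun τ hτ => hΩ (hc' τ hτ), hℓ⟩

end Eikonal

/-! ### Metrics and their inverses -/

section InverseMetric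

variable {V : Type} [NormedAddCommGroup V] [NormedSpace ℝ V]

/-- `G` is symmetric and positive definite on `O`, and `B` is its inverse, as a map from covectors
to vectors. -/
structure IsInverseMetric (G : V → V →L[ℝ] V →L[ℝ] ℝ) (B : V → (V →L[ℝ] ℝ) →L[ℝ] V)
    (O : Set V) : Prop where
  symm : ∀ z ∈ O, ∀ v w, G z v w = G z w v
  pos : ∀ z ∈ O, ∀ v, v ≠ 0 → 0 < G z v v
  apply_apply : ∀ z ∈ O, ∀ ξ v, G z (B z ξ) v = ξ v

variable {G : V → V →L[ℝ] V →L[ℝ] ℝ} {B : V → (V →L[ℝ] ℝ) →L[ℝ] V} {O : Set V}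

lemma IsInverseMetric.dual_symm (h : IsInverseMetric G B O) {z : V} (hz : z ∈ O)
    (ξ ζ : V →L[ℝ] ℝ) : ζ (B z ξ) = ξ (B z ζ) := by
  rw [← h.apply_apply z hz ζ, ← h.apply_apply z hz ξ, h.symm z hz]

lemma IsInverseMetric.dual_pos (h : IsInverseMetric G B O) {z : V} (hz : z ∈ O)
    (ξ : V →L[ℝ] ℝ) (hξ : ξ ≠ 0) : 0 < ξ (B z ξ) := by
  rw [← h.apply_apply z hz ξ]
  refine h.pos z hz _ fun h0 => hξ ?_
  ext v
  rw [← h.apply_apply z hz ξ v, h0]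
  simp

/-- The Cauchy–Schwarz inequality. -/
lemma IsInverseMetric.sq_apply_le (h : IsInverseMetric G B O) {z : V} (hz : z ∈ O)
    (ξ : V →L[ℝ] ℝ) (v : V) : (ξ v) ^ 2 ≤ ξ (B z ξ) * G z v v := by
  rw [← h.apply_apply z hz ξ v, ← h.apply_apply z hz ξ (B z ξ)]
  generalize B z ξ = u
  rcases eq_or_ne v 0 with rfl | hv
  · simp
  · have hvv := h.pos z hz v hv
    have hnn : 0 ≤ G z (G z v v • u - G z u v • v) (G z v v • u - G z u v • v) := by
      rcases eq_or_ne (G z v v • u - G z u v • v) 0 with h0 | h0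
      · rw [h0]; simp
      · exact (h.pos z hz _ h0).le
    have hexp : G z (G z v v • u - G z u v • v) (G z v v • u - G z u v • v) =
        G z v v * (G z u u * G z v v - (G z u v) ^ 2) := by
      simp only [map_sub, map_smul, sub_apply, smul_apply,
        smul_eq_mul, h.symm z hz v u]
      ring
    rw [hexp] at hnn
    nlinarith [nonneg_of_mul_nonneg_right hnn hvv]

end InverseMetric

/-! ### Trajectories starting conormally to a slice -/

section Conormal

variable {E F : Type} [NormedAddCommGroup E] [NormedSpace ℝ E] [FiniteDimensional ℝ E]
  [NormedAddCommGroup F] [NormedSpace ℝ F] [FiniteDimensional ℝ F]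

/-- The phase space point with position `(x, 0)`, momentum conormal to the slice `E × 0`, and given
coupling constant, as a linear map. -/
noncomputable def conormal (E F : Type) [NormedAddCommGroup E] [NormedSpace ℝ E]
    [NormedAddCommGroup F] [NormedSpace ℝ F] :
    ((E × (F →L[ℝ] ℝ)) × ℝ) →L[ℝ] PhaseSpace (E × F) :=
  ((ContinuousLinearMap.inl ℝ E F).comp
      ((ContinuousLinearMap.fst ℝ E (F →L[ℝ] ℝ)).comp (ContinuousLinearMap.fst ℝ _ ℝ))).prod
    ((((ContinuousLinearMap.compL ℝ (E × F) F ℝ).flip (ContinuousLinearMap.snd ℝ E F)).comp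
      ((ContinuousLinearMap.snd ℝ E (F →L[ℝ] ℝ)).comp (ContinuousLinearMap.fst ℝ _ ℝ))).prod
      (ContinuousLinearMap.snd ℝ _ ℝ))

omit [FiniteDimensional ℝ E] [FiniteDimensional ℝ F] in
@[simp] lemma conormal_apply (a : E × (F →L[ℝ] ℝ)) (κ : ℝ) :
    conormal E F (a, κ) = ((a.1, 0), a.2.comp (ContinuousLinearMap.snd ℝ E F), κ) := rfl

variable {B : E × F → ((E × F) →L[ℝ] ℝ) →L[ℝ] (E × F)} {P : E × F → ℝ} {s : ℝ}
  {N : Set (PhaseSpace (E × F))} {O : Set (E × F)}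
  {Γ : PhaseSpace (E × F) → C(unitInterval, PhaseSpace (E × F))}

/-- The linearized flow at an equilibrium point. -/
lemma fderiv_flow_equilibrium {V : Type} [NormedAddCommGroup V] [NormedSpace ℝ V] [CompleteSpace V]
    {B : V → (V →L[ℝ] ℝ) →L[ℝ] V} {P : V → ℝ} {s : ℝ} {N : Set (PhaseSpace V)} {O : Set V}
    {Γ : PhaseSpace V → C(unitInterval, PhaseSpace V)}
    (hB : ContDiff ℝ ∞ B) (hP : ContDiff ℝ ∞ P)
    (hΓ : IsLocalFlow (contDiff_newtonField hB hP).continuous s N (Prod.fst ⁻¹' O) Γ)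
    {z : V} (hw : (z, 0, 0) ∈ N) (h : PhaseSpace V) (h0 : h.2.2 = 0) :
    (fderiv ℝ Γ (z, 0, 0) h 1).1 = h.1 + s • B z h.2.1 := by
  have hconst := hΓ.eq_const _ hw (newtonField_eq_zero z)
  have hX := contDiff_newtonField hB hP
  set D := fderiv ℝ Γ (z, 0, 0) h with hD
  have hd : ∀ τ ∈ Ioo (0 : ℝ) 1, HasDerivAt (fun r => D (projIcc 0 1 zero_le_one r))
      (s • fderiv ℝ (newtonField B P) (z, 0, 0) (D (projIcc 0 1 zero_le_one τ))) τ := by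
    intro τ hτ
    have := hΓ.hasDerivAt_fderiv hX hw h hτ
    rwa [hconst] at this
  have hD0 : D 0 = h := hΓ.fderiv_apply_zero hX hw h
  have hξ : ∀ τ ∈ Icc (0 : ℝ) 1, (D (projIcc 0 1 zero_le_one τ)).2.1 = h.2.1 := by
    intro τ hτ
    refine eq_on_unitInterval_of_hasDerivAt'
      (u := fun r => (D (projIcc 0 1 zero_le_one r)).2.1) (v := fun _ => h.2.1)
      (d := fun _ => 0) (by fun_prop) continuous_const (fun r hr => ?_)
      (fun r _ => hasDerivAt_const r _) (by simp [hD0]) hτ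
    have h1 : HasDerivAt (fun r => (D (projIcc 0 1 zero_le_one r)).2.1) _ r :=
      (hasFDerivAt_fst.comp _ hasFDerivAt_snd).comp_hasDerivAt r (hd r hr)
    refine h1.congr_deriv ?_
    have h2 := fderiv_flow_coupling_eq hB hP hΓ hw h (projIcc 0 1 zero_le_one r)
    simp only [ContinuousLinearMap.comp_apply, ContinuousLinearMap.coe_fst',
      ContinuousLinearMap.coe_snd', Prod.smul_fst, Prod.smul_snd,
      fderiv_newtonField_zero_apply_snd_fst hB hP]
    rw [← hD, h0] at h2
    simp [h2]
  have key := eq_on_unitInterval_of_hasDerivAt'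
      (u := fun r => (D (projIcc 0 1 zero_le_one r)).1) (v := fun τ => h.1 + τ • (s • B z h.2.1))
      (d := fun _ => s • B z h.2.1) (by fun_prop) (by fun_prop) (fun r hr => ?_)
      (fun r _ => by simpa using ((hasDerivAt_id r).smul_const (s • B z h.2.1)).const_add h.1)
      (by simp [hD0]) (right_mem_Icc.2 zero_le_one)
  · simpa using key
  · have h1 : HasDerivAt (fun r => (D (projIcc 0 1 zero_le_one r)).1) _ r :=
      hasFDerivAt_fst.comp_hasDerivAt r (hd r hr)
    refine h1.congr_deriv ?_
    simp only [ContinuousLinearMap.coe_fst', Prod.smul_fst, fderiv_newtonField_apply_fst hB hP]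
    rw [hξ r ⟨hr.1.le, hr.2.le⟩]
    simp

/-- The normal exponential map is a local diffeomorphism at the zero covector, whatever the choice
of the coupling constant `k`, provided `k` vanishes to second order there. -/
lemma exists_fderiv_endpoint_eq_equiv (hB : ContDiff ℝ ∞ B) (hP : ContDiff ℝ ∞ P) (hs : 0 < s)
    (hΓ : IsLocalFlow (contDiff_newtonField hB hP).continuous s N (Prod.fst ⁻¹' O) Γ)
    (hpos : ∀ z ∈ O, ∀ ξ : (E × F) →L[ℝ] ℝ, ξ ≠ 0 → 0 < ξ (B z ξ))
    {x₀ : E} (hx₀ : (x₀, 0) ∈ O) (hw : ((x₀, 0), 0, 0) ∈ N) {k : E × (F →L[ℝ] ℝ) → ℝ}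
    (hk0 : k (x₀, 0) = 0) (hk : HasFDerivAt k (0 : (E × (F →L[ℝ] ℝ)) →L[ℝ] ℝ) (x₀, 0)) :
    ∃ D : (E × (F →L[ℝ] ℝ)) ≃L[ℝ] (E × F),
      fderiv ℝ (fun a => (Γ (conormal E F (a, k a)) 1).1) (x₀, 0) = D := by
  have hσ : conormal E F ((x₀, 0), k (x₀, 0)) = ((x₀, 0), 0, 0) := by simp [hk0]
  have h1 : HasFDerivAt (fun a => conormal E F (a, k a))
      ((conormal E F).comp ((ContinuousLinearMap.id ℝ _).prod 0)) (x₀, 0) :=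
    (conormal E F).hasFDerivAt.comp _ ((hasFDerivAt_id _).prodMk hk)
  have h2 : HasFDerivAt (fun a => (Γ (conormal E F (a, k a)) 1).1) _ (x₀, 0) :=
    (hasFDerivAt_fst.comp _ (hΓ.hasFDerivAt_apply (hσ ▸ hw) 1)).comp _ h1
  rw [h2.fderiv]
  set D₀ := ((ContinuousLinearMap.fst ℝ (E × F) (((E × F) →L[ℝ] ℝ) × ℝ)).comp
    ((ContinuousMap.evalCLM ℝ 1).comp (fderiv ℝ Γ (conormal E F ((x₀, 0), k (x₀, 0)))))).comp
      ((conormal E F).comp ((ContinuousLinearMap.id ℝ _).prod 0)) with hD₀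
  have hD : ∀ h, D₀ h = (h.1, 0) + s • B (x₀, 0) (h.2.comp (ContinuousLinearMap.snd ℝ E F)) := by
    intro h
    have := fderiv_flow_equilibrium hB hP hΓ hw (conormal E F (h, 0)) rfl
    rw [hD₀, hσ]
    simpa using this
  -- pairing the image of `h` with the covector `h.2` kills the tangential part
  have hinj : Function.Injective (D₀ : (E × (F →L[ℝ] ℝ)) →ₗ[ℝ] (E × F)) := by
    rw [← LinearMap.ker_eq_bot, LinearMap.ker_eq_bot']
    intro h hh
    have hh' : (h.1, (0 : F)) + s • B (x₀, 0) (h.2.comp (ContinuousLinearMap.snd ℝ E F)) = 0 :=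
      (hD h).symm.trans hh
    have h3 := congrArg (h.2.comp (ContinuousLinearMap.snd ℝ E F)) hh'
    have h4 : h.2.comp (ContinuousLinearMap.snd ℝ E F) = 0 := by
      by_contra hne
      have h5 := hpos _ hx₀ _ hne
      rw [map_add, map_smul, map_zero, smul_eq_mul] at h3
      have h6 : h.2.comp (ContinuousLinearMap.snd ℝ E F) (h.1, (0 : F)) = 0 := by simp
      rw [h6, zero_add] at h3
      exact absurd h3 (mul_pos hs h5).ne'
    have h5 : h.2 = 0 := by
      ext y
      simpa using congrArg (fun A : (E × F) →L[ℝ] ℝ => A (0, y)) h4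
    rw [h4, map_zero, smul_zero, add_zero] at hh'
    have h6 : h.1 = 0 := congrArg Prod.fst hh'
    exact Prod.ext h6 h5
  have hrank : Module.finrank ℝ (E × (F →L[ℝ] ℝ)) = Module.finrank ℝ (E × F) := by
    have : Module.finrank ℝ (F →L[ℝ] ℝ) = Module.finrank ℝ F := by
      rw [← (LinearMap.toContinuousLinearMap (𝕜 := ℝ) (E := F) (F' := ℝ)).finrank_eq]
      simp
    simp [this]
  refine ⟨(LinearEquiv.ofInjectiveOfFinrankEq _ hinj hrank).toContinuousLinearEquiv, ?_⟩
  ext h <;> rfl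

end Conormal

/-! ### Squared distances from families of trajectories -/

section Family

variable {E F : Type} [NormedAddCommGroup E] [NormedSpace ℝ E] [FiniteDimensional ℝ E]
  [NormedAddCommGroup F] [NormedSpace ℝ F] [FiniteDimensional ℝ F]
  {B : E × F → ((E × F) →L[ℝ] ℝ) →L[ℝ] (E × F)} {P : E × F → ℝ} {s : ℝ}
  {N : Set (PhaseSpace (E × F))} {O : Set (E × F)}
  {Γ : PhaseSpace (E × F) → C(unitInterval, PhaseSpace (E × F))}

/-- The trajectories of Newtonian motion are `C¹` curves. -/
lemma exists_contDiff_trajectory {V : Type} [NormedAddCommGroup V] [NormedSpace ℝ V]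
    [CompleteSpace V] {B : V → (V →L[ℝ] ℝ) →L[ℝ] V} {P : V → ℝ} {s : ℝ} {N : Set (PhaseSpace V)}
    {O : Set V} {Γ : PhaseSpace V → C(unitInterval, PhaseSpace V)}
    (hB : ContDiff ℝ ∞ B) (hP : ContDiff ℝ ∞ P)
    (hΓ : IsLocalFlow (contDiff_newtonField hB hP).continuous s N (Prod.fst ⁻¹' O) Γ)
    {w : PhaseSpace V} (hw : w ∈ N) :
    ∃ c : ℝ → V, ContDiff ℝ 1 c ∧ ∀ τ (hτ : τ ∈ Icc (0 : ℝ) 1), c τ = (Γ w ⟨τ, hτ⟩).1 ∧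
      deriv c τ = s • B (Γ w ⟨τ, hτ⟩).1 (Γ w ⟨τ, hτ⟩).2.1 := by
  let u : ℝ → V := fun r => s • B (Γ w (projIcc 0 1 zero_le_one r)).1
    (Γ w (projIcc 0 1 zero_le_one r)).2.1
  have hu : Continuous u :=
    ((hB.continuous.comp (by fun_prop)).clm_apply (by fun_prop)).const_smul s
  have hd : ∀ τ, HasDerivAt (fun τ => w.1 + ∫ r in (0 : ℝ)..τ, u r) (u τ) τ := fun τ =>
    (intervalIntegral.integral_hasDerivAt_right (hu.intervalIntegrable 0 τ)
      hu.aestronglyMeasurable.stronglyMeasurableAtFilter hu.continuousAt).const_add w.1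
  refine ⟨fun τ => w.1 + ∫ r in (0 : ℝ)..τ, u r, ?_, fun τ hτ => ⟨?_, ?_⟩⟩
  · rw [contDiff_one_iff_deriv]
    refine ⟨fun τ => (hd τ).differentiableAt, ?_⟩
    rw [show deriv _ = u from funext fun τ => (hd τ).deriv]
    exact hu
  · have := eq_on_unitInterval_of_hasDerivAt'
      (u := fun τ => w.1 + ∫ r in (0 : ℝ)..τ, u r)
      (v := fun r => (Γ w (projIcc 0 1 zero_le_one r)).1) (d := u)
      (continuous_iff_continuousAt.2 fun τ => (hd τ).continuousAt) (by fun_prop)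
      (fun r _ => hd r) (fun r hr => by
        have h1 : HasDerivAt (fun r => (Γ w (projIcc 0 1 zero_le_one r)).1) _ r :=
          hasFDerivAt_fst.comp_hasDerivAt r (hΓ.hasDerivAt hw hr)
        exact h1.congr_deriv (by simp [newtonField, u]))
      (by simp [hΓ.apply_zero hw]) hτ
    simpa [projIcc_of_mem zero_le_one hτ] using this
  · rw [(hd τ).deriv]
    simp [u, projIcc_of_mem zero_le_one hτ]

/-- The end points of the trajectories starting conormally to the slice `E × 0`, with coupling
constant `k`. -/
noncomputable def endpoint (Γ : PhaseSpace (E × F) → C(unitInterval, PhaseSpace (E × F)))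
    (k : E × (F →L[ℝ] ℝ) → ℝ) (a : E × (F →L[ℝ] ℝ)) : E × F :=
  (Γ (conormal E F (a, k a)) 1).1

omit [FiniteDimensional ℝ E] [FiniteDimensional ℝ F] in
lemma contDiffOn_endpoint (hΓ : ContDiffOn ℝ ∞ Γ N) {A : Set (E × (F →L[ℝ] ℝ))}
    {k : E × (F →L[ℝ] ℝ) → ℝ} (hk : ContDiffOn ℝ ∞ k A)
    (hkN : ∀ a ∈ A, conormal E F (a, k a) ∈ N) : ContDiffOn ℝ ∞ (endpoint Γ k) A := by
  have h1 : ContDiffOn ℝ ∞ (fun a => conormal E F (a, k a)) A :=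
    (conormal E F).contDiff.comp_contDiffOn (contDiffOn_id.prodMk hk)
  exact contDiff_fst.comp_contDiffOn ((ContinuousMap.evalCLM ℝ 1 :
    C(unitInterval, PhaseSpace (E × F)) →L[ℝ] _).contDiff.comp_contDiffOn (hΓ.comp h1 hkN))

omit [FiniteDimensional ℝ E] [FiniteDimensional ℝ F] in
lemma endpoint_slice (hB : ContDiff ℝ ∞ B) (hP : ContDiff ℝ ∞ P)
    (hΓ : IsLocalFlow (contDiff_newtonField hB hP).continuous s N (Prod.fst ⁻¹' O) Γ)
    {k : E × (F →L[ℝ] ℝ) → ℝ} {x : E} (hx : conormal E F ((x, 0), k (x, 0)) ∈ N)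
    (hk : k (x, 0) = 0) : endpoint Γ k (x, 0) = (x, 0) := by
  have h : conormal E F ((x, 0), k (x, 0)) = ((x, 0), 0, 0) := by simp [hk]
  rw [endpoint, hΓ.eq_const _ hx (by rw [h]; exact newtonField_eq_zero _), h]
  rfl

/-- If the derivative of `T'` along the family of end points is the momentum multiplied by `μ`,
where `μ²` has the right size, then `T'`, read off at the end points, solves the eikonal
equation. -/
theorem exists_isEikonalSquare_of_endpoint (hB : ContDiff ℝ ∞ B) (hP : ContDiff ℝ ∞ P) (hs : 0 < s)
    (hΓ : IsLocalFlow (contDiff_newtonField hB hP).continuous s N (Prod.fst ⁻¹' O) Γ)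
    {G : E × F → (E × F) →L[ℝ] (E × F) →L[ℝ] ℝ} (hG : IsInverseMetric G B O)
    {A : Set (E × (F →L[ℝ] ℝ))} (hA : IsOpen A) {k : E × (F →L[ℝ] ℝ) → ℝ}
    (hk : ContDiffOn ℝ ∞ k A) (hkN : ∀ a ∈ A, conormal E F (a, k a) ∈ N)
    (hk0 : ∀ x, (x, 0) ∈ A → k (x, 0) = 0)
    {x₀ : E} (hx₀ : (x₀, 0) ∈ A) (hk' : HasFDerivAt k (0 : (E × (F →L[ℝ] ℝ)) →L[ℝ] ℝ) (x₀, 0))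
    {R : E × F → ℝ} {T' μ : E × (F →L[ℝ] ℝ) → ℝ} (hT' : ContDiffOn ℝ ∞ T' A)
    (hderiv : ∀ a ∈ A, ∀ h, fderiv ℝ T' a h =
      μ a * (Γ (conormal E F (a, k a)) 1).2.1 (fderiv ℝ (endpoint Γ k) a h))
    (hμ : ∀ a ∈ A, μ a ^ 2 * (Γ (conormal E F (a, k a)) 1).2.1
      (B (endpoint Γ k a) (Γ (conormal E F (a, k a)) 1).2.1) = 4 * T' a * R (endpoint Γ k a))
    (hnonneg : ∀ a ∈ A, 0 ≤ T' a) (hzero : ∀ a ∈ A, T' a = 0 ↔ a.2 = 0)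
    (hlen : ∀ a ∈ A, ∃ ℓ : ℝ → ℝ, Continuous ℓ ∧ (∀ τ (hτ : τ ∈ Icc (0 : ℝ) 1), 0 ≤ ℓ τ ∧
      R (Γ (conormal E F (a, k a)) ⟨τ, hτ⟩).1 * (s ^ 2 *
        (Γ (conormal E F (a, k a)) ⟨τ, hτ⟩).2.1 (B (Γ (conormal E F (a, k a)) ⟨τ, hτ⟩).1
          (Γ (conormal E F (a, k a)) ⟨τ, hτ⟩).2.1)) = ℓ τ ^ 2) ∧
      ∫ τ in (0 : ℝ)..1, ℓ τ = √(T' a)) :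
    ∃ e : OpenPartialHomeomorph (E × (F →L[ℝ] ℝ)) (E × F), (x₀, 0) ∈ e.source ∧ e.source ⊆ A ∧
      (e : E × (F →L[ℝ] ℝ) → E × F) = endpoint Γ k ∧ ContDiffOn ℝ ∞ e.symm e.target ∧
      (∀ x, (x, 0) ∈ e.source → e (x, 0) = (x, 0)) ∧
      IsEikonalSquare (fun z v => R z * G z v v) {z | z.2 = 0}
        (e.target ∩ {z | (z.1, 0) ∈ e.source}) O (fun z => T' (e.symm z)) := by
  have hw : ((x₀, (0 : F)), (0 : (E × F) →L[ℝ] ℝ), (0 : ℝ)) ∈ N := by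
    have := hkN _ hx₀
    rwa [hk0 _ hx₀] at this
  have hO₀ : (x₀, (0 : F)) ∈ O := by
    have := hΓ.mem _ hw 0
    rwa [hΓ.apply_zero hw] at this
  obtain ⟨D, hD⟩ := exists_fderiv_endpoint_eq_equiv hB hP hs hΓ (fun z hz => hG.dual_pos hz)
    hO₀ hw (hk0 _ hx₀) hk'
  have hΘ := contDiffOn_endpoint hΓ.contDiffOn hk hkN
  obtain ⟨e, hae, heA, he, hes⟩ :=
    exists_openPartialHomeomorph_contDiffOn_symm hA hΘ hx₀ D hD
  have hslice : ∀ x, (x, 0) ∈ e.source → e (x, 0) = (x, 0) := fun x hx => by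
    rw [he]
    exact endpoint_slice hB hP hΓ (hkN _ (heA hx)) (hk0 _ (heA hx))
  refine ⟨e, hae, heA, he, hes, hslice, ?_⟩
  have hmem : ∀ a ∈ A, ∀ τ, (Γ (conormal E F (a, k a)) τ).1 ∈ O := fun a ha τ =>
    hΓ.mem _ (hkN a ha) τ
  have hend : ∀ z ∈ e.target, endpoint Γ k (e.symm z) = z := fun z hz => by
    rw [← he]; exact e.right_inv hz
  constructor
  · exact (hT'.comp hes fun z hz => heA (e.map_target hz)).mono inter_subset_left
  · exact fun z hz => hnonneg _ (heA (e.map_target hz.1))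
  · intro z hz
    rw [hzero _ (heA (e.map_target hz.1))]
    constructor
    · intro h
      have h1 : e.symm z = ((e.symm z).1, 0) := Prod.ext rfl h
      have h2 := hslice (e.symm z).1 (h1 ▸ e.map_target hz.1)
      rw [← h1, e.right_inv hz.1] at h2
      exact congrArg Prod.snd h2
    · intro h
      have h1 : z = (z.1, 0) := Prod.ext rfl h
      have h2 := hslice z.1 hz.2
      rw [← h1] at h2
      rw [← h2, e.left_inv hz.2]
  · intro z hz v
    have haA := heA (e.map_target hz.1)
    have hsd : HasFDerivAt e.symm (fderiv ℝ e.symm z) z :=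
      ((hes.contDiffAt (e.open_target.mem_nhds hz.1)).differentiableAt (by simp)).hasFDerivAt
    have hTd : HasFDerivAt T' (fderiv ℝ T' (e.symm z)) (e.symm z) :=
      ((hT'.contDiffAt (hA.mem_nhds haA)).differentiableAt (by simp)).hasFDerivAt
    have hΘd : HasFDerivAt (endpoint Γ k) (fderiv ℝ (endpoint Γ k) (e.symm z)) (e.symm z) :=
      ((hΘ.contDiffAt (hA.mem_nhds haA)).differentiableAt (by simp)).hasFDerivAt
    have h1 : fderiv ℝ (endpoint Γ k) (e.symm z) (fderiv ℝ e.symm z v) = v := by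
      have h2 : HasFDerivAt (endpoint Γ k ∘ e.symm) (ContinuousLinearMap.id ℝ _) z := by
        refine (hasFDerivAt_id z).congr_of_eventuallyEq ?_
        filter_upwards [e.open_target.mem_nhds hz.1] with y hy using hend y hy
      exact congrArg (fun L : (E × F) →L[ℝ] (E × F) => L v) ((hΘd.comp z hsd).unique h2)
    have h3 : fderiv ℝ (fun z => T' (e.symm z)) z v =
        fderiv ℝ T' (e.symm z) (fderiv ℝ e.symm z v) := by
      rw [HasFDerivAt.fderiv (f := fun z => T' (e.symm z)) (hTd.comp z hsd)]
      rfl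
    rw [h3, hderiv _ haA, h1]
    have h4 := hμ _ haA
    rw [hend z hz.1] at h4
    have hzO : z ∈ O := by
      have := hmem _ haA 1
      rwa [show (Γ (conormal E F (e.symm z, k (e.symm z))) 1).1 = z from hend z hz.1] at this
    have h5 := hG.sq_apply_le hzO (Γ (conormal E F (e.symm z, k (e.symm z))) 1).2.1 v
    calc _ = μ (e.symm z) ^ 2 * ((Γ (conormal E F (e.symm z, k (e.symm z))) 1).2.1 v) ^ 2 := by
          ring
      _ ≤ μ (e.symm z) ^ 2 * _ := mul_le_mul_of_nonneg_left h5 (sq_nonneg _)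
      _ = _ := by rw [← mul_assoc, h4]; ring
  · intro z hz
    have haA := heA (e.map_target hz.1)
    obtain ⟨c, hc, hcτ⟩ := exists_contDiff_trajectory hB hP hΓ (hkN _ haA)
    obtain ⟨ℓ, hℓ, hℓτ, hint⟩ := hlen _ haA
    refine ⟨c, hc, ?_, ?_, fun τ hτ => ?_, ℓ, hℓ, fun τ hτ => ⟨(hℓτ τ hτ).1, ?_⟩, hint⟩
    · have h0 := (hcτ 0 (left_mem_Icc.2 zero_le_one)).1
      have h1 := hΓ.apply_zero (hkN _ haA)
      rw [h0]
      change (Γ (conormal E F (e.symm z, k (e.symm z))) 0).1.2 = 0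
      rw [h1]
      rfl
    · rw [(hcτ 1 (right_mem_Icc.2 zero_le_one)).1]
      exact hend z hz.1
    · rw [(hcτ τ hτ).1]
      exact hmem _ haA _
    · rw [(hcτ τ hτ).1, (hcτ τ hτ).2, ← (hℓτ τ hτ).2]
      simp only [map_smul, smul_apply, smul_eq_mul,
        hG.apply_apply _ (hmem _ haA ⟨τ, hτ⟩)]
      ring

/-- The Gauss lemma for trajectories starting conormally to the slice. -/
lemma momentum_apply_fderiv_endpoint (hB : ContDiff ℝ ∞ B) (hP : ContDiff ℝ ∞ P)
    (hsym : ∀ z ∈ O, ∀ ξ ζ : (E × F) →L[ℝ] ℝ, ζ (B z ξ) = ξ (B z ζ))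
    (hΓ : IsLocalFlow (contDiff_newtonField hB hP).continuous s N (Prod.fst ⁻¹' O) Γ)
    {k : E × (F →L[ℝ] ℝ) → ℝ} {a : E × (F →L[ℝ] ℝ)} (hk : DifferentiableAt ℝ k a)
    (ha : conormal E F (a, k a) ∈ N) (h : E × (F →L[ℝ] ℝ)) :
    (Γ (conormal E F (a, k a)) 1).2.1 (fderiv ℝ (endpoint Γ k) a h) =
      s * (1 / 2 * fderiv ℝ k a h * potentialIntegral hP Γ (conormal E F (a, k a)) +
        k a * fderiv ℝ (fun a => potentialIntegral hP Γ (conormal E F (a, k a))) a h +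
        1 / 2 * fderiv ℝ (fun a => newtonEnergy B P (conormal E F (a, k a))) a h) := by
  have h1 : HasFDerivAt (fun a => conormal E F (a, k a))
      ((conormal E F).comp ((ContinuousLinearMap.id ℝ _).prod (fderiv ℝ k a))) a :=
    (conormal E F).hasFDerivAt.comp _ ((hasFDerivAt_id _).prodMk hk.hasFDerivAt)
  have h2' : HasFDerivAt (fun w => (Γ w 1).1) _ (conormal E F (a, k a)) :=
    hasFDerivAt_fst.comp _ (hΓ.hasFDerivAt_apply ha 1)
  have h2 : HasFDerivAt (endpoint Γ k) _ a :=
    HasFDerivAt.comp (g := fun w => (Γ w 1).1) a h2' h1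
  have h3 : HasFDerivAt (fun a => potentialIntegral hP Γ (conormal E F (a, k a))) _ a :=
    HasFDerivAt.comp (g := potentialIntegral hP Γ) a
      (((contDiffOn_potentialIntegral hP hΓ.contDiffOn).contDiffAt
      (hΓ.isOpen.mem_nhds ha)).differentiableAt (by simp)).hasFDerivAt h1
  have h4 : HasFDerivAt (fun a => newtonEnergy B P (conormal E F (a, k a))) _ a :=
    HasFDerivAt.comp (g := newtonEnergy B P) a
      ((contDiff_newtonEnergy hB hP).differentiable (by simp) _).hasFDerivAt h1
  have key := momentum_apply_fderiv_flow hB hP hsym hΓ ha (conormal E F (h, fderiv ℝ k a h))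
  rw [h2.fderiv, h3.fderiv, h4.fderiv]
  refine Eq.trans key ?_
  simp

end Family

section Cutoff

variable {V : Type} [NormedAddCommGroup V] [NormedSpace ℝ V] [FiniteDimensional ℝ V]

/-- Near any point, the inverse of a Riemannian metric agrees with a smooth map defined on the whole
space. -/
lemma exists_isInverseMetric {Ω : Set V} (hΩ : IsOpen Ω) {G : V → V →L[ℝ] V →L[ℝ] ℝ}
    (hG : ContDiffOn ℝ ∞ G Ω) (hsymm : ∀ z ∈ Ω, ∀ v w, G z v w = G z w v)
    (hpos : ∀ z ∈ Ω, ∀ v, v ≠ 0 → 0 < G z v v) {z₀ : V} (hz₀ : z₀ ∈ Ω) :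
    ∃ B : V → (V →L[ℝ] ℝ) →L[ℝ] V, ContDiff ℝ ∞ B ∧ ∃ r > 0, Metric.ball z₀ r ⊆ Ω ∧
      IsInverseMetric G B (Metric.ball z₀ r) := by
  have hequiv : ∀ z ∈ Ω, ∃ L : V ≃L[ℝ] (V →L[ℝ] ℝ), (L : V →L[ℝ] V →L[ℝ] ℝ) = G z := by
    intro z hz
    have hinj : Function.Injective (G z : V →ₗ[ℝ] V →L[ℝ] ℝ) := by
      rw [← LinearMap.ker_eq_bot, LinearMap.ker_eq_bot']
      intro v hv
      by_contra hne
      have h1 := hpos z hz v hne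
      have h2 : G z v = 0 := hv
      simp [h2] at h1
    have hrank : Module.finrank ℝ V = Module.finrank ℝ (V →L[ℝ] ℝ) := by
      rw [← (LinearMap.toContinuousLinearMap (𝕜 := ℝ) (E := V) (F' := ℝ)).finrank_eq]
      simp
    exact ⟨(LinearEquiv.ofInjectiveOfFinrankEq _ hinj hrank).toContinuousLinearEquiv, ContinuousLinearMap.ext fun _ => rfl⟩
  have hinv : ContDiffOn ℝ ∞ (fun z => (G z).inverse) Ω := by
    intro z hz
    obtain ⟨L, hL⟩ := hequiv z hz
    have h1 := contDiffAt_map_inverse (n := ∞) L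
    rw [hL] at h1
    exact h1.comp_contDiffWithinAt z (hG z hz)
  obtain ⟨B, hB, r, hr, hrΩ, hBr⟩ := exists_contDiff_eqOn_nhds hΩ hinv hz₀
  refine ⟨B, hB, r, hr, hrΩ, fun z hz => hsymm z (hrΩ hz), fun z hz => hpos z (hrΩ hz), ?_⟩
  intro z hz ξ v
  obtain ⟨L, hL⟩ := hequiv z (hrΩ hz)
  have : B z = (G z).inverse := hBr hz
  rw [this, ← hL, ContinuousLinearMap.inverse_equiv]
  simp

end Cutoff

/-! ### Squared distances by geodesics and by motion of energy zero -/

section Conormal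

variable {E F : Type} [NormedAddCommGroup E] [NormedSpace ℝ E] [FiniteDimensional ℝ E]
  [NormedAddCommGroup F] [NormedSpace ℝ F] [FiniteDimensional ℝ F]
  {B : E × F → ((E × F) →L[ℝ] ℝ) →L[ℝ] (E × F)} {P : E × F → ℝ} {s : ℝ}
  {N : Set (PhaseSpace (E × F))} {O : Set (E × F)}
  {Γ : PhaseSpace (E × F) → C(unitInterval, PhaseSpace (E × F))}
  {G : E × F → (E × F) →L[ℝ] (E × F) →L[ℝ] ℝ}

/-- The squared length of a covector conormal to the slice `E × 0`. -/
noncomputable def conormalSq (B : E × F → ((E × F) →L[ℝ] ℝ) →L[ℝ] (E × F))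
    (a : E × (F →L[ℝ] ℝ)) : ℝ :=
  newtonEnergy B 0 (conormal E F (a, 0))

omit [FiniteDimensional ℝ E] [FiniteDimensional ℝ F] in
lemma newtonEnergy_conormal (a : E × (F →L[ℝ] ℝ)) (κ : ℝ) :
    newtonEnergy B P (conormal E F (a, κ)) = conormalSq B a - κ * P (a.1, 0) := by
  simp [newtonEnergy, conormalSq]

omit [FiniteDimensional ℝ E] [FiniteDimensional ℝ F] in
lemma contDiff_conormalSq (hB : ContDiff ℝ ∞ B) : ContDiff ℝ ∞ (conormalSq B) :=
  (contDiff_newtonEnergy hB (P := 0) contDiff_const).comp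
    ((conormal E F).contDiff.comp (contDiff_id.prodMk contDiff_const))

omit [FiniteDimensional ℝ E] [FiniteDimensional ℝ F] in
lemma conormalSq_zero (x : E) : conormalSq B (x, 0) = 0 := by
  simp [conormalSq, newtonEnergy]

omit [FiniteDimensional ℝ E] [FiniteDimensional ℝ F] in
lemma conormalSq_pos (hG : IsInverseMetric G B O) {a : E × (F →L[ℝ] ℝ)} (ha : (a.1, 0) ∈ O)
    (h0 : a.2 ≠ 0) : 0 < conormalSq B a := by
  have h1 : a.2.comp (ContinuousLinearMap.snd ℝ E F) ≠ 0 := fun h => h0 <| by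
    ext y
    simpa using congrArg (fun A : (E × F) →L[ℝ] ℝ => A (0, y)) h
  simpa [conormalSq, newtonEnergy] using hG.dual_pos ha _ h1

omit [FiniteDimensional ℝ E] [FiniteDimensional ℝ F] in
lemma conormalSq_nonneg (hG : IsInverseMetric G B O) {a : E × (F →L[ℝ] ℝ)} (ha : (a.1, 0) ∈ O) :
    0 ≤ conormalSq B a := by
  by_cases h : a.2 = 0
  · rw [show a = (a.1, 0) from Prod.ext rfl h, conormalSq_zero]
  · exact (conormalSq_pos hG ha h).le

omit [FiniteDimensional ℝ E] [FiniteDimensional ℝ F] in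
lemma conormalSq_eq_zero_iff (hG : IsInverseMetric G B O) {a : E × (F →L[ℝ] ℝ)}
    (ha : (a.1, 0) ∈ O) : conormalSq B a = 0 ↔ a.2 = 0 := by
  refine ⟨fun h => ?_, fun h => ?_⟩
  · by_contra h0
    exact (conormalSq_pos hG ha h0).ne' h
  · rw [show a = (a.1, 0) from Prod.ext rfl h, conormalSq_zero]

omit [FiniteDimensional ℝ E] [FiniteDimensional ℝ F] in
lemma fst_mem_of_conormal_mem (hB : ContDiff ℝ ∞ B) (hP : ContDiff ℝ ∞ P)
    (hΓ : IsLocalFlow (contDiff_newtonField hB hP).continuous s N (Prod.fst ⁻¹' O) Γ)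
    {a : E × (F →L[ℝ] ℝ)} {κ : ℝ} (ha : conormal E F (a, κ) ∈ N) : (a.1, 0) ∈ O := by
  have := hΓ.mem _ ha 0
  rwa [hΓ.apply_zero ha] at this

/-- The squared metric distance to the slice, in terms of geodesics (motion with coupling
constant `0`) starting conormally to the slice. -/
theorem exists_isEikonalSquare_geodesic (hB : ContDiff ℝ ∞ B) (hP : ContDiff ℝ ∞ P) (hs : 0 < s)
    (hΓ : IsLocalFlow (contDiff_newtonField hB hP).continuous s N (Prod.fst ⁻¹' O) Γ)
    (hG : IsInverseMetric G B O) {x₀ : E} (hx₀ : ((x₀, 0), 0, 0) ∈ N) :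
    ∃ e : OpenPartialHomeomorph (E × (F →L[ℝ] ℝ)) (E × F), (x₀, 0) ∈ e.source ∧
      e.source ⊆ {a | conormal E F (a, 0) ∈ N} ∧
      (e : E × (F →L[ℝ] ℝ) → E × F) = endpoint Γ (fun _ => 0) ∧
      ContDiffOn ℝ ∞ e.symm e.target ∧ (∀ x, (x, 0) ∈ e.source → e (x, 0) = (x, 0)) ∧
      IsEikonalSquare (fun z v => G z v v) {z | z.2 = 0}
        (e.target ∩ {z | (z.1, 0) ∈ e.source}) O (fun z => s ^ 2 * conormalSq B (e.symm z)) := by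
  have hA : IsOpen {a : E × (F →L[ℝ] ℝ) | conormal E F (a, 0) ∈ N} :=
    hΓ.isOpen.preimage ((conormal E F).continuous.comp (continuous_id.prodMk continuous_const))
  have hen : ∀ a : E × (F →L[ℝ] ℝ), conormal E F (a, 0) ∈ N → ∀ τ,
      (Γ (conormal E F (a, 0)) τ).2.1 (B (Γ (conormal E F (a, 0)) τ).1
        (Γ (conormal E F (a, 0)) τ).2.1) = conormalSq B a := by
    intro a ha τ
    have h1 := newtonEnergy_flow_eq hB hP (fun z hz => hG.dual_symm hz) hΓ ha τ
    rw [newtonEnergy_conormal, newtonEnergy, flow_coupling_eq hB hP hΓ ha τ] at h1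
    simpa using h1
  have hc := contDiff_conormalSq (E := E) (F := F) hB
  have key := exists_isEikonalSquare_of_endpoint hB hP hs hΓ hG hA (k := fun _ => 0)
    contDiffOn_const (fun _ ha => ha) (fun _ _ => rfl) (x₀ := x₀) (by simpa using hx₀)
    (hasFDerivAt_const _ _) (R := fun _ => 1) (T' := fun a => s ^ 2 * conormalSq B a)
    (μ := fun _ => 2 * s) (contDiff_const.mul hc).contDiffOn ?_ ?_ ?_ ?_ ?_
  · simpa using key
  · intro a ha h
    rw [momentum_apply_fderiv_endpoint hB hP (fun z hz => hG.dual_symm hz) hΓ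
      (differentiableAt_const _) ha,
      fderiv_const_mul (hc.differentiable (by simp) a)]
    simp only [newtonEnergy_conormal]
    simp
    ring
  · intro a ha
    have := hen a ha 1
    simp only [endpoint]
    rw [this]
    ring
  · exact fun a ha => mul_nonneg (sq_nonneg _)
      (conormalSq_nonneg hG (fst_mem_of_conormal_mem hB hP hΓ ha))
  · intro a ha
    rw [mul_eq_zero_iff_left (by positivity),
      conormalSq_eq_zero_iff hG (fst_mem_of_conormal_mem hB hP hΓ ha)]
  · intro a ha
    have h0 := conormalSq_nonneg hG (fst_mem_of_conormal_mem hB hP hΓ ha)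
    refine ⟨fun _ => s * √(conormalSq B a), continuous_const, fun τ hτ => ⟨by positivity, ?_⟩, ?_⟩
    · rw [hen a ha, mul_pow, Real.sq_sqrt h0, one_mul]
    · rw [intervalIntegral.integral_const, Real.sqrt_mul (sq_nonneg s), Real.sqrt_sq hs.le]
      simp

/-- The coupling constant for which a trajectory starting conormally to the slice has energy
zero. -/
noncomputable def zeroEnergyCoupling (B : E × F → ((E × F) →L[ℝ] ℝ) →L[ℝ] (E × F)) (P : E × F → ℝ)
    (a : E × (F →L[ℝ] ℝ)) : ℝ :=
  conormalSq B a / P (a.1, 0)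

omit [FiniteDimensional ℝ E] [FiniteDimensional ℝ F] in
lemma contDiffOn_zeroEnergyCoupling (hB : ContDiff ℝ ∞ B) (hP : ContDiff ℝ ∞ P)
    (hpos : ∀ z ∈ O, 0 < P z) :
    ContDiffOn ℝ ∞ (zeroEnergyCoupling B P) {a : E × (F →L[ℝ] ℝ) | (a.1, 0) ∈ O} :=
  (contDiff_conormalSq hB).contDiffOn.div
    (hP.comp (contDiff_fst.prodMk contDiff_const)).contDiffOn fun _ ha => (hpos _ ha).ne'

omit [FiniteDimensional ℝ E] [FiniteDimensional ℝ F] in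
lemma zeroEnergyCoupling_zero (x : E) : zeroEnergyCoupling B P (x, 0) = 0 := by
  simp [zeroEnergyCoupling, conormalSq_zero]

omit [FiniteDimensional ℝ E] [FiniteDimensional ℝ F] in
lemma potentialIntegral_pos (hB : ContDiff ℝ ∞ B) (hP : ContDiff ℝ ∞ P)
    (hΓ : IsLocalFlow (contDiff_newtonField hB hP).continuous s N (Prod.fst ⁻¹' O) Γ)
    (hpos : ∀ z ∈ O, 0 < P z) {w : PhaseSpace (E × F)} (hw : w ∈ N) :
    0 < potentialIntegral hP Γ w := by
  rw [potentialIntegral_eq]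
  refine intervalIntegral.intervalIntegral_pos_of_pos_on
    ((hP.continuous.comp (by fun_prop)).intervalIntegrable _ _) (fun r _ => ?_) zero_lt_one
  exact hpos _ (hΓ.mem w hw _)

/-- The squared distance to the slice for the metric `P G`, in terms of motion of energy zero
starting conormally to the slice: by Maupertuis' principle, these trajectories are the geodesics
of `P G` up to parametrization. -/
theorem exists_isEikonalSquare_zeroEnergy (hB : ContDiff ℝ ∞ B) (hP : ContDiff ℝ ∞ P) (hs : 0 < s)
    (hΓ : IsLocalFlow (contDiff_newtonField hB hP).continuous s N (Prod.fst ⁻¹' O) Γ) (hO : IsOpen O)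
    (hG : IsInverseMetric G B O) (hpos : ∀ z ∈ O, 0 < P z) {x₀ : E} (hx₀ : ((x₀, 0), 0, 0) ∈ N) :
    ∃ e : OpenPartialHomeomorph (E × (F →L[ℝ] ℝ)) (E × F), (x₀, 0) ∈ e.source ∧
      e.source ⊆ {a | conormal E F (a, zeroEnergyCoupling B P a) ∈ N} ∧
      (e : E × (F →L[ℝ] ℝ) → E × F) = endpoint Γ (zeroEnergyCoupling B P) ∧
      ContDiffOn ℝ ∞ e.symm e.target ∧ (∀ x, (x, 0) ∈ e.source → e (x, 0) = (x, 0)) ∧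
      IsEikonalSquare (fun z v => P z * G z v v) {z | z.2 = 0}
        (e.target ∩ {z | (z.1, 0) ∈ e.source}) O
        (fun z => s ^ 2 * zeroEnergyCoupling B P (e.symm z) * potentialIntegral hP Γ
          (conormal E F (e.symm z, zeroEnergyCoupling B P (e.symm z))) ^ 2) := by
  set ε : E × (F →L[ℝ] ℝ) → ℝ := zeroEnergyCoupling B P with hε
  have hO' : IsOpen {a : E × (F →L[ℝ] ℝ) | (a.1, 0) ∈ O} :=
    hO.preimage (continuous_fst.prodMk continuous_const)
  have hεs : ContDiffOn ℝ ∞ ε {a : E × (F →L[ℝ] ℝ) | (a.1, 0) ∈ O} :=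
    contDiffOn_zeroEnergyCoupling hB hP hpos
  set A : Set (E × (F →L[ℝ] ℝ)) := {a | (a.1, 0) ∈ O} ∩ {a | conormal E F (a, ε a) ∈ N}
  have hA : IsOpen A := ContinuousOn.isOpen_inter_preimage
    (f := fun a => conormal E F (a, ε a))
    ((conormal E F).continuous.comp_continuousOn (continuousOn_id.prodMk hεs.continuousOn)) hO'
    hΓ.isOpen
  have hεA : ContDiffOn ℝ ∞ ε A := hεs.mono inter_subset_left
  have hε0 : ∀ x, ε (x, 0) = 0 := fun x => zeroEnergyCoupling_zero x
  have hεnn : ∀ a ∈ A, 0 ≤ ε a := fun a ha =>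
    div_nonneg (conormalSq_nonneg hG ha.1) (hpos _ ha.1).le
  have hen0 : ∀ a ∈ A, newtonEnergy B P (conormal E F (a, ε a)) = 0 := by
    intro a ha
    rw [newtonEnergy_conormal, hε, zeroEnergyCoupling, div_mul_cancel₀ _ (hpos _ ha.1).ne', sub_self]
  have hen : ∀ a ∈ A, ∀ τ,
      (Γ (conormal E F (a, ε a)) τ).2.1 (B (Γ (conormal E F (a, ε a)) τ).1
        (Γ (conormal E F (a, ε a)) τ).2.1) = ε a * P (Γ (conormal E F (a, ε a)) τ).1 := by
    intro a ha τ
    have h1 := newtonEnergy_flow_eq hB hP (fun z hz => hG.dual_symm hz) hΓ ha.2 τ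
    rw [hen0 a ha, newtonEnergy, flow_coupling_eq hB hP hΓ ha.2 τ] at h1
    exact sub_eq_zero.1 h1
  have hx₀' : (x₀, (0 : F →L[ℝ] ℝ)) ∈ A := by
    have h1 : conormal E F ((x₀, 0), ε (x₀, 0)) ∈ N := by simpa [hε0] using hx₀
    exact ⟨fst_mem_of_conormal_mem hB hP hΓ h1, h1⟩
  -- `ε` has a minimum at `(x₀, 0)`
  have hε' : HasFDerivAt ε (0 : (E × (F →L[ℝ] ℝ)) →L[ℝ] ℝ) (x₀, 0) := by
    have h1 : HasFDerivAt ε (fderiv ℝ ε (x₀, 0)) (x₀, 0) :=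
      ((hεA.contDiffAt (hA.mem_nhds hx₀')).differentiableAt (by simp)).hasFDerivAt
    have h2 : IsLocalMin ε (x₀, 0) := by
      filter_upwards [hA.mem_nhds hx₀'] with a ha
      rw [hε0]
      exact hεnn a ha
    rwa [h2.fderiv_eq_zero] at h1
  have hSs : ContDiffOn ℝ ∞ (fun a => potentialIntegral hP Γ (conormal E F (a, ε a))) A :=
    (contDiffOn_potentialIntegral hP hΓ.contDiffOn).comp
      ((conormal E F).contDiff.comp_contDiffOn (contDiffOn_id.prodMk hεA)) fun a ha => ha.2
  have hSpos : ∀ a ∈ A, 0 < potentialIntegral hP Γ (conormal E F (a, ε a)) := fun a ha =>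
    potentialIntegral_pos hB hP hΓ hpos ha.2
  have key := exists_isEikonalSquare_of_endpoint hB hP hs hΓ hG hA (k := ε)
    hεA (fun _ ha => ha.2) (fun x _ => hε0 x) hx₀' hε' (R := P)
    (T' := fun a => s ^ 2 * ε a * potentialIntegral hP Γ (conormal E F (a, ε a)) ^ 2)
    (μ := fun a => 2 * s * potentialIntegral hP Γ (conormal E F (a, ε a)))
    ((contDiffOn_const.mul hεA).mul (hSs.pow 2)) ?_ ?_ ?_ ?_ ?_
  · obtain ⟨e, h1, h2, h3⟩ := key
    exact ⟨e, h1, fun a ha => (h2 ha).2, h3⟩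
  · intro a ha h
    have hεd := ((hεA.contDiffAt (hA.mem_nhds ha)).differentiableAt (by simp))
    have hSd := ((hSs.contDiffAt (hA.mem_nhds ha)).differentiableAt (by simp))
    have hE : fderiv ℝ (fun a => newtonEnergy B P (conormal E F (a, ε a))) a = 0 := by
      rw [Filter.EventuallyEq.fderiv_eq (f := fun _ => (0 : ℝ)) (by
        filter_upwards [hA.mem_nhds ha] with b hb using hen0 b hb)]
      simp
    rw [momentum_apply_fderiv_endpoint hB hP (fun z hz => hG.dual_symm hz) hΓ hεd ha.2, hE]
    have hd := ((hεd.hasFDerivAt.const_mul (s ^ 2)).mul (hSd.hasFDerivAt.pow 2)).fderiv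
    rw [show (fun a => s ^ 2 * ε a * potentialIntegral hP Γ (conormal E F (a, ε a)) ^ 2) =
      (fun a => s ^ 2 * ε a) * (fun a => potentialIntegral hP Γ (conormal E F (a, ε a))) ^ 2 from rfl]
    erw [hd]
    simp
    ring
  · intro a ha
    have := hen a ha 1
    simp only [endpoint]
    rw [this]
    ring
  · exact fun a ha => mul_nonneg (mul_nonneg (sq_nonneg _) (hεnn a ha)) (sq_nonneg _)
  · intro a ha
    have h1 := (hSpos a ha).ne'
    have h2 := (hpos _ ha.1).ne'
    rw [mul_eq_zero_iff_right (by positivity), mul_eq_zero_iff_left (by positivity), hε,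
      zeroEnergyCoupling, div_eq_zero_iff, or_iff_left h2, conormalSq_eq_zero_iff hG ha.1]
  · intro a ha
    have h0 := hεnn a ha
    have hS := (hSpos a ha).le
    refine ⟨fun r => s * √(ε a) * P (Γ (conormal E F (a, ε a)) (projIcc 0 1 zero_le_one r)).1,
      continuous_const.mul (hP.continuous.comp (by fun_prop)), fun τ hτ => ⟨?_, ?_⟩, ?_⟩
    · have := (hpos _ (hΓ.mem _ ha.2 (projIcc 0 1 zero_le_one τ))).le
      positivity
    · beta_reduce
      rw [hen a ha, projIcc_of_mem zero_le_one hτ, mul_pow, mul_pow, Real.sq_sqrt h0]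
      ring
    · rw [intervalIntegral.integral_const_mul, ← potentialIntegral_eq hP,
        Real.sqrt_mul (by positivity), Real.sqrt_sq hS, Real.sqrt_mul (sq_nonneg s),
        Real.sqrt_sq hs.le]

end Conormal

/-! ### The quotient of two squared distances in coordinates -/

section Conformal

variable {E F : Type} [NormedAddCommGroup E] [NormedSpace ℝ E] [FiniteDimensional ℝ E]
  [NormedAddCommGroup F] [NormedSpace ℝ F] [FiniteDimensional ℝ F]

/-- Hadamard's lemma near a point, for a nonnegative function: the quotient `Q` vanishes where the
parameter and the function do, since these are minima of the function. -/
lemma exists_contDiff_eqOn_add_mul {A : Type} [NormedAddCommGroup A] [NormedSpace ℝ A]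
    [FiniteDimensional ℝ A] {D : Set (A × ℝ)} (hD : IsOpen D) {q : A × ℝ → ℝ}
    (hq : ContDiffOn ℝ ∞ q D) (hnn : ∀ p ∈ D, 0 ≤ q p) {p₀ : A × ℝ} (hp₀ : p₀ ∈ D) :
    ∃ Q : A × ℝ → ℝ, ContDiff ℝ ∞ Q ∧ ∃ U : Set (A × ℝ), IsOpen U ∧ p₀ ∈ U ∧ U ⊆ D ∧
      (∀ a ε, (a, ε) ∈ U → (a, 0) ∈ U → q (a, ε) = q (a, 0) + ε * Q (a, ε)) ∧
      ∀ a, (a, 0) ∈ U → q (a, 0) = 0 → Q (a, 0) = 0 := by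
  obtain ⟨q', hq', r, hr, hrD, hqq⟩ := exists_contDiff_eqOn_nhds hD hq hp₀
  obtain ⟨Q, hQ, hQ1, hQ2⟩ := exists_contDiff_eq_add_mul hq'
  refine ⟨Q, hQ, Metric.ball p₀ r, Metric.isOpen_ball, Metric.mem_ball_self hr, hrD,
    fun a ε h1 h2 => ?_, fun a ha h0 => ?_⟩
  · rw [← hqq h1, ← hqq h2]
    exact hQ1 a ε
  · have h2 : IsLocalMin q' (a, 0) := by
      filter_upwards [Metric.isOpen_ball.mem_nhds ha] with b hb
      rw [hqq ha, hqq hb, h0]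
      exact hnn _ (hrD hb)
    rw [hQ2, h2.fderiv_eq_zero]
    rfl

/-- The local form of the theorem: near a point of the slice `E × 0`, the quotient of the squared
distances to the slice for the metrics `P G` and `G` is a smooth function, equal to `P` on the
slice. -/
theorem exists_isEikonalSquare_conformal {Ω : Set (E × F)} (hΩ : IsOpen Ω)
    {G : E × F → (E × F) →L[ℝ] (E × F) →L[ℝ] ℝ} (hG : ContDiffOn ℝ ∞ G Ω)
    (hsymm : ∀ z ∈ Ω, ∀ v w, G z v w = G z w v) (hpos : ∀ z ∈ Ω, ∀ v, v ≠ 0 → 0 < G z v v)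
    {P : E × F → ℝ} (hP : ContDiffOn ℝ ∞ P Ω) (hPpos : ∀ z ∈ Ω, 0 < P z)
    {x₀ : E} (hx₀ : (x₀, 0) ∈ Ω) :
    ∃ O : Set (E × F), IsOpen O ∧ (x₀, 0) ∈ O ∧ O ⊆ Ω ∧ ∃ T₁ T₂ K : E × F → ℝ,
      IsEikonalSquare (fun z v => P z * G z v v) {z | z.2 = 0} O Ω T₁ ∧
      IsEikonalSquare (fun z v => G z v v) {z | z.2 = 0} O Ω T₂ ∧
      ContDiffOn ℝ ∞ K O ∧
      ∀ z ∈ O, 0 < K z ∧ T₁ z = K z * T₂ z ∧ (z.2 = 0 → K z = P z) := by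
  obtain ⟨B, hB, r₁, hr₁, hr₁Ω, hGB⟩ := exists_isInverseMetric hΩ hG hsymm hpos hx₀
  obtain ⟨P', hP', r₂, hr₂, hr₂Ω, hPP⟩ := exists_contDiff_eqOn_nhds hΩ hP hx₀
  set O₀ : Set (E × F) := Metric.ball (x₀, 0) r₁ ∩ Metric.ball (x₀, 0) r₂
  have hO₀ : IsOpen O₀ := Metric.isOpen_ball.inter Metric.isOpen_ball
  have hx₀O : (x₀, 0) ∈ O₀ := ⟨Metric.mem_ball_self hr₁, Metric.mem_ball_self hr₂⟩
  have hO₀Ω : O₀ ⊆ Ω := fun z hz => hr₁Ω hz.1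
  have hGB' : IsInverseMetric G B O₀ :=
    ⟨fun z hz => hGB.symm z hz.1, fun z hz => hGB.pos z hz.1, fun z hz => hGB.apply_apply z hz.1⟩
  have hPP' : ∀ z ∈ O₀, P' z = P z := fun z hz => hPP hz.2
  have hPpos' : ∀ z ∈ O₀, 0 < P' z := fun z hz => hPP' z hz ▸ hPpos z (hO₀Ω hz)
  obtain ⟨s, hs, N, hN, Γ, hΓ⟩ := exists_smooth_flow (contDiff_newtonField hB hP')
    (((x₀, 0), 0, 0) : PhaseSpace (E × F)) (hO₀.preimage continuous_fst) hx₀O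
  obtain ⟨e₁, h₁x, h₁N, he₁, he₁s, h₁slice, hT₁⟩ :=
    exists_isEikonalSquare_zeroEnergy hB hP' hs hΓ hO₀ hGB' hPpos' hN
  obtain ⟨e₂, h₂x, h₂N, he₂, he₂s, h₂slice, hT₂⟩ :=
    exists_isEikonalSquare_geodesic hB hP' hs hΓ hGB' hN
  set ε : E × (F →L[ℝ] ℝ) → ℝ := zeroEnergyCoupling B P' with hε
  have hε0 : ∀ x, ε (x, 0) = 0 := fun x => zeroEnergyCoupling_zero x
  -- the squared `G`-distance at the end point of the trajectory with coupling constant `κ`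
  have hcon : Continuous fun p : (E × (F →L[ℝ] ℝ)) × ℝ => conormal E F p := (conormal E F).continuous
  have hend : ContDiffOn ℝ ∞ (fun p : (E × (F →L[ℝ] ℝ)) × ℝ => (Γ (conormal E F p) 1).1)
      {p | conormal E F p ∈ N} :=
    contDiff_fst.comp_contDiffOn ((ContinuousMap.evalCLM ℝ 1 :
      C(unitInterval, PhaseSpace (E × F)) →L[ℝ] _).contDiff.comp_contDiffOn
        (hΓ.contDiffOn.comp (conormal E F).contDiff.contDiffOn fun _ hp => hp))
  set D : Set ((E × (F →L[ℝ] ℝ)) × ℝ) := {p | conormal E F p ∈ N} ∩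
    (fun p => (Γ (conormal E F p) 1).1) ⁻¹' e₂.target
  have hD : IsOpen D :=
    hend.continuousOn.isOpen_inter_preimage (hΓ.isOpen.preimage hcon) e₂.open_target
  have hq : ContDiffOn ℝ ∞ (fun p : (E × (F →L[ℝ] ℝ)) × ℝ =>
      s ^ 2 * conormalSq B (e₂.symm (Γ (conormal E F p) 1).1)) D :=
    contDiffOn_const.mul ((contDiff_conormalSq hB).comp_contDiffOn
      (he₂s.comp (hend.mono inter_subset_left) fun _ hp => hp.2))
  have hq0 : ∀ a ∈ e₂.source, e₂.symm (Γ (conormal E F (a, 0)) 1).1 = a := by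
    intro a ha
    have := e₂.left_inv ha
    rwa [he₂] at this
  have hmem₂ : ∀ z ∈ e₂.target, ((e₂.symm z).1, 0) ∈ O₀ := fun z hz =>
    fst_mem_of_conormal_mem hB hP' hΓ (h₂N (e₂.map_target hz))
  have hp₀ : (((x₀, (0 : F →L[ℝ] ℝ)), (0 : ℝ)) : (E × (F →L[ℝ] ℝ)) × ℝ) ∈ D := by
    refine ⟨h₂N h₂x, ?_⟩
    have := e₂.map_source h₂x
    rwa [he₂] at this
  -- it differs from the squared length of the initial covector by a multiple of `κ`
  obtain ⟨Q, hQ, U, hU, hp₀U, hUD, hQ1, hQ2⟩ := exists_contDiff_eqOn_add_mul hD hq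
    (fun p hp => mul_nonneg (sq_nonneg s) (conormalSq_nonneg hGB' (hmem₂ _ hp.2))) hp₀
  -- the domain of the quotient, in terms of the initial values of the trajectories
  have hεs : ContDiffOn ℝ ∞ ε e₁.source :=
    (contDiffOn_zeroEnergyCoupling hB hP' hPpos').mono fun a ha =>
      fst_mem_of_conormal_mem hB hP' hΓ (h₁N ha)
  have hQs : ContDiffOn ℝ ∞ (fun a => s ^ 2 * P' (a.1, 0) + Q (a, ε a)) e₁.source :=
    (contDiff_const.mul (hP'.comp (contDiff_fst.prodMk contDiff_const))).contDiffOn.add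
      (hQ.comp_contDiffOn (contDiffOn_id.prodMk hεs))
  have hSs : ContDiffOn ℝ ∞ (fun a => potentialIntegral hP' Γ (conormal E F (a, ε a))) e₁.source :=
    (contDiffOn_potentialIntegral hP' hΓ.contDiffOn).comp
      ((conormal E F).contDiff.comp_contDiffOn (contDiffOn_id.prodMk hεs)) fun a ha => h₁N ha
  set A : Set (E × (F →L[ℝ] ℝ)) := ((e₁.source ∩ (fun a => (a, ε a)) ⁻¹' U) ∩
    (e₁.source ∩ (fun a => s ^ 2 * P' (a.1, 0) + Q (a, ε a)) ⁻¹' Ioi 0)) ∩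
    (e₂.source ∩ (fun a => (a, (0 : ℝ))) ⁻¹' U)
  have hA : IsOpen A :=
    (((continuousOn_id.prodMk hεs.continuousOn).isOpen_inter_preimage e₁.open_source hU).inter
      (hQs.continuousOn.isOpen_inter_preimage e₁.open_source isOpen_Ioi)).inter
      (e₂.open_source.inter (hU.preimage (continuous_id.prodMk continuous_const)))
  have hqslice : ∀ x, (x, 0) ∈ e₂.source →
      s ^ 2 * conormalSq B (e₂.symm (Γ (conormal E F ((x, 0), 0)) 1).1) = 0 := by
    intro x hx
    rw [hq0 _ hx, conormalSq_zero, mul_zero]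
  have hx₀A : (x₀, (0 : F →L[ℝ] ℝ)) ∈ A := by
    have h0 : ((x₀, (0 : F →L[ℝ] ℝ)), ε (x₀, 0)) ∈ U := by rw [hε0]; exact hp₀U
    refine ⟨⟨⟨h₁x, h0⟩, h₁x, ?_⟩, h₂x, hp₀U⟩
    change 0 < s ^ 2 * P' (x₀, 0) + Q ((x₀, 0), ε (x₀, 0))
    rw [hε0, hQ2 _ hp₀U (hqslice _ h₂x), add_zero]
    exact mul_pos (pow_pos hs 2) (hPpos' _ hx₀O)
  set K' : E × (F →L[ℝ] ℝ) → ℝ := fun a =>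
    s ^ 2 * potentialIntegral hP' Γ (conormal E F (a, ε a)) ^ 2 /
      (s ^ 2 * P' (a.1, 0) + Q (a, ε a)) with hK'
  have hA₁ : A ⊆ e₁.source := fun a ha => ha.1.1.1
  have hK's : ContDiffOn ℝ ∞ K' A :=
    (contDiffOn_const.mul ((hSs.mono hA₁).pow 2)).div (hQs.mono hA₁) fun a ha => (ha.1.2.2).ne'
  have hO₁ : IsOpen {z : E × F | (z.1, (0 : F →L[ℝ] ℝ)) ∈ e₁.source} :=
    e₁.open_source.preimage (continuous_fst.prodMk continuous_const)
  have hO₂ : IsOpen {z : E × F | (z.1, (0 : F →L[ℝ] ℝ)) ∈ e₂.source} :=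
    e₂.open_source.preimage (continuous_fst.prodMk continuous_const)
  have hxt : ∀ x, (x, (0 : F →L[ℝ] ℝ)) ∈ e₁.source → e₁.symm (x, 0) = (x, 0) := fun x hx => by
    have := e₁.left_inv hx
    rwa [h₁slice x hx] at this
  have hmem₁ : ∀ a ∈ e₁.source, (a.1, 0) ∈ O₀ := fun a ha =>
    fst_mem_of_conormal_mem hB hP' hΓ (h₁N ha)
  have hend₁ : ∀ z ∈ e₁.target,
      (Γ (conormal E F (e₁.symm z, ε (e₁.symm z))) 1).1 = z := fun z hz => by
    have := e₁.right_inv hz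
    rwa [he₁] at this
  have hOO₀ : e₁.target ⊆ O₀ := fun z hz => by
    have := hΓ.mem _ (h₁N (e₁.map_target hz)) 1
    rwa [mem_preimage, hend₁ z hz] at this
  refine ⟨(e₁.target ∩ e₁.symm ⁻¹' A) ∩
    ({z | (z.1, 0) ∈ e₁.source} ∩ (e₂.target ∩ {z | (z.1, 0) ∈ e₂.source})),
    (e₁.symm.isOpen_inter_preimage hA).inter (hO₁.inter (e₂.open_target.inter hO₂)), ?_,
    fun z hz => hO₀Ω (hOO₀ hz.1.1),
    fun z => s ^ 2 * ε (e₁.symm z) * potentialIntegral hP' Γ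
      (conormal E F (e₁.symm z, ε (e₁.symm z))) ^ 2,
    fun z => s ^ 2 * conormalSq B (e₂.symm z), fun z => K' (e₁.symm z), ?_, ?_, ?_, ?_⟩
  · have h1 := e₁.map_source h₁x
    have h2 := e₂.map_source h₂x
    rw [h₁slice _ h₁x] at h1
    rw [h₂slice _ h₂x] at h2
    refine ⟨⟨h1, ?_⟩, h₁x, h2, h₂x⟩
    rw [mem_preimage, hxt _ h₁x]
    exact hx₀A
  · refine ((hT₁.mono (fun z hz => ⟨hz.1.1, hz.2.1⟩) Subset.rfl).congr (fun z hz => hOO₀ hz.1.1)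
      fun z hz v => ?_).mono Subset.rfl hO₀Ω
    rw [hPP' z hz]
  · exact hT₂.mono (fun z hz => hz.2.2) hO₀Ω
  · exact hK's.comp (he₁s.mono fun z hz => hz.1.1) fun z hz => hz.1.2
  · intro z hz
    have ha := hz.1.2
    have hzt := hz.1.1
    have hend := hend₁ z hzt
    have hslice : z.2 = 0 → e₁.symm z = (z.1, 0) := fun h => by
      rw [← hxt z.1 hz.2.1, ← show z = (z.1, 0) from Prod.ext rfl h]
    have hzz : z.2 = 0 → z = (z.1, 0) := fun h => Prod.ext rfl h
    rw [mem_preimage] at ha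
    beta_reduce
    generalize e₁.symm z = a at ha hend hslice
    have hden : 0 < s ^ 2 * P' (a.1, 0) + Q (a, ε a) := ha.1.2.2
    have hS := potentialIntegral_pos hB hP' hΓ hPpos' (h₁N (hA₁ ha))
    refine ⟨div_pos (by positivity) hden, ?_, fun h0 => ?_⟩
    · have h1 := hQ1 a (ε a) ha.1.1.2 ha.2.2
      rw [hend, hq0 a ha.2.1] at h1
      have h2 : conormalSq B a = ε a * P' (a.1, 0) := by
        rw [hε, zeroEnergyCoupling, div_mul_cancel₀ _ (hPpos' _ (hmem₁ a (hA₁ ha))).ne']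
      rw [h1, h2, hK']
      field_simp
    · have ha0 : a = (z.1, 0) := hslice h0
      have hN₁ : conormal E F (a, ε a) ∈ N := h₁N (hA₁ ha)
      have hQ0 : Q (a, ε a) = 0 := by
        rw [ha0, hε0]
        exact hQ2 _ (ha0 ▸ ha.2.2) (hqslice _ (ha0 ▸ ha.2.1))
      have hS0 : potentialIntegral hP' Γ (conormal E F (a, ε a)) = P' z := by
        have h3 : conormal E F (a, ε a) = ((z.1, 0), 0, 0) := by
          rw [ha0, hε0]
          simp
        rw [potentialIntegral_eq, hΓ.eq_const _ hN₁ (by rw [h3]; exact newtonField_eq_zero _), h3]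
        change (∫ _ in (0 : ℝ)..1, P' (z.1, 0)) = P' z
        rw [← hzz h0]
        simp
      have hPz := hPpos' z (hOO₀ hzt)
      rw [← hPP' z (hOO₀ hzt), hK']
      beta_reduce
      rw [hQ0, hS0, ha0, ← hzz h0]
      field_simp
      simp

end Conformal

/-! ### Slice charts of embedded submanifolds -/

section SliceChart

/-- Around a point of a smoothly embedded submanifold there is a chart in which the submanifold is
a linear slice. -/
lemma exists_slice_chart {n m : ℕ} {M : Type*} [TopologicalSpace M]
    [ChartedSpace (EuclideanSpace ℝ (Fin m)) M] [IsManifold (𝓡 m) ∞ M]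
    {S : Type*} [TopologicalSpace S] [ChartedSpace (EuclideanSpace ℝ (Fin n)) S]
    [IsManifold (𝓡 n) ∞ S] {ι : S → M} (hι : Manifold.IsSmoothEmbedding (𝓡 n) (𝓡 m) ∞ ι) (s : S) :
    ∃ (F : Type) (_ : NormedAddCommGroup F) (_ : NormedSpace ℝ F) (_ : FiniteDimensional ℝ F)
      (ψ : OpenPartialHomeomorph M (EuclideanSpace ℝ (Fin n) × F)), ι s ∈ ψ.source ∧
      ContMDiffOn (𝓡 m) 𝓘(ℝ, EuclideanSpace ℝ (Fin n) × F) ∞ ψ ψ.source ∧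
      ContMDiffOn 𝓘(ℝ, EuclideanSpace ℝ (Fin n) × F) (𝓡 m) ∞ ψ.symm ψ.target ∧
      ∀ p ∈ ψ.source, p ∈ range ι ↔ (ψ p).2 = 0 := by
  have h := hι.isImmersion.isImmersionAt s
  have hfin : FiniteDimensional ℝ h.complement :=
    FiniteDimensional.of_injective ((h.equiv.toLinearEquiv : _ →ₗ[ℝ] EuclideanSpace ℝ (Fin m)).comp
      (LinearMap.inr ℝ (EuclideanSpace ℝ (Fin n)) h.complement))
      (h.equiv.injective.comp (Prod.mk_right_injective 0))
  refine ⟨h.complement, inferInstance, inferInstance, hfin, ?_⟩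
  have hcod : ∀ s' ∈ h.domChart.source, h.codChart (ι s') = h.equiv (h.domChart s', 0) := by
    intro s' hs'
    have h1 := h.writtenInCharts (show h.domChart s' ∈ (h.domChart.extend (𝓡 n)).target by
      simpa using h.domChart.map_source hs')
    simpa [h.domChart.left_inv hs'] using h1
  obtain ⟨W, hW, hWD⟩ := hι.isEmbedding.isOpen_iff.1 h.domChart.open_source
  let ψ₀ : OpenPartialHomeomorph M (EuclideanSpace ℝ (Fin n) × h.complement) :=
    h.codChart.trans h.equiv.symm.toHomeomorph.toOpenPartialHomeomorph
  have hψ₀ : ∀ p, ψ₀ p = h.equiv.symm (h.codChart p) := fun _ => rfl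
  have hψ₀s : ψ₀.source = h.codChart.source := by simp [ψ₀]
  have hψ₀t : ψ₀.target = h.equiv ⁻¹' h.codChart.target := by
    simp [ψ₀]
  have hψ₀symm : ∀ z, ψ₀.symm z = h.codChart.symm (h.equiv z) := fun _ => rfl
  have hO : IsOpen (W ∩ (ψ₀.source ∩ ψ₀ ⁻¹' (Prod.fst ⁻¹' h.domChart.target))) :=
    hW.inter (ψ₀.isOpen_inter_preimage (h.domChart.open_target.preimage continuous_fst))
  refine ⟨ψ₀.restrOpen _ hO, ?_, ?_, ?_, ?_⟩
  · have h0 : ι s ∈ ψ₀.source := by rw [hψ₀s]; exact h.mem_codChart_source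
    refine ⟨h0, ?_, h0, ?_⟩
    · have : s ∈ ι ⁻¹' W := hWD ▸ h.mem_domChart_source
      exact this
    · change (ψ₀ (ι s)).1 ∈ h.domChart.target
      rw [hψ₀, hcod s h.mem_domChart_source, ContinuousLinearEquiv.symm_apply_apply]
      exact h.domChart.map_source h.mem_domChart_source
  · have h1 : ContMDiffOn (𝓡 m) (𝓡 m) ∞ h.codChart h.codChart.source :=
      contMDiffOn_of_mem_maximalAtlas h.codChart_mem_maximalAtlas
    exact (h.equiv.symm.contDiff.contMDiff.comp_contMDiffOn h1).mono fun p hp => hψ₀s ▸ hp.1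
  · have h1 : ContMDiffOn (𝓡 m) (𝓡 m) ∞ h.codChart.symm h.codChart.target :=
      contMDiffOn_symm_of_mem_maximalAtlas h.codChart_mem_maximalAtlas
    refine h1.comp h.equiv.contDiff.contMDiff.contMDiffOn fun z hz => ?_
    have h2 : z ∈ ψ₀.target := hz.1
    rwa [hψ₀t] at h2
  · rintro p ⟨hp, hpW, -, hpt⟩
    change _ ↔ (ψ₀ p).2 = 0
    constructor
    · rintro ⟨s', rfl⟩
      have hs' : s' ∈ h.domChart.source := hWD ▸ hpW
      rw [hψ₀, hcod s' hs', ContinuousLinearEquiv.symm_apply_apply]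
    · intro h0
      have hs' := h.domChart.map_target hpt
      refine ⟨h.domChart.symm (ψ₀ p).1, ?_⟩
      refine h.codChart.injOn (h.source_subset_preimage_source hs') (hψ₀s ▸ hp) ?_
      rw [hcod _ hs', h.domChart.right_inv hpt, ← h0]
      change h.equiv (ψ₀ p) = _
      rw [hψ₀, ContinuousLinearEquiv.apply_symm_apply]

end SliceChart

/-! ### Lengths and distances of a Riemannian metric -/

section Length

open MeasureTheory

variable {m : ℕ} {M : Type*} [TopologicalSpace M] [ChartedSpace (EuclideanSpace ℝ (Fin m)) M]
  [IsManifold (𝓡 m) ∞ M]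

/-- The length of the restriction to the unit interval of a path, with respect to the metric `g`. -/
noncomputable def metricLength (g : SmoothRiemannianMetric m M) (γ : ℝ → M) : ENNReal :=
  letI : Bundle.RiemannianBundle (fun x : M => TangentSpace (𝓡 m) x) := ⟨g.toRiemannianMetric⟩
  Manifold.pathELength (𝓡 m) γ 0 1

lemma metricLength_eq (g : SmoothRiemannianMetric m M) (γ : ℝ → M) :
    metricLength g γ = ∫⁻ t in Icc (0 : ℝ) 1, ENNReal.ofReal
      √(g.inner (γ t) (mfderivWithin 𝓘(ℝ, ℝ) (𝓡 m) γ (Icc 0 1) t (1 : ℝ))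
        (mfderivWithin 𝓘(ℝ, ℝ) (𝓡 m) γ (Icc 0 1) t (1 : ℝ))) := by
  let : Bundle.RiemannianBundle (fun x : M => TangentSpace (𝓡 m) x) := ⟨g.toRiemannianMetric⟩
  have h : ∀ (x : M) (v : TangentSpace (𝓡 m) x), ‖v‖ₑ = ENNReal.ofReal √(g.inner x v v) := by
    intro x v
    rw [← ofReal_norm, norm_eq_sqrt_real_inner]
    rfl
  rw [metricLength, Manifold.pathELength_eq_lintegral_mfderivWithin_Icc]
  simp only [h]
  rfl

lemma metricLength_congr (g : SmoothRiemannianMetric m M) {γ γ' : ℝ → M}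
    (h : EqOn γ γ' (Icc 0 1)) : metricLength g γ = metricLength g γ' :=
  letI : Bundle.RiemannianBundle (fun x : M => TangentSpace (𝓡 m) x) := ⟨g.toRiemannianMetric⟩
  Manifold.pathELength_congr h

lemma metricEDist_le_metricLength (g : SmoothRiemannianMetric m M) {γ : ℝ → M}
    (hγ : ContMDiffOn 𝓘(ℝ, ℝ) (𝓡 m) 1 γ (Icc 0 1)) :
    metricEDist g (γ 0) (γ 1) ≤ metricLength g γ :=
  letI : Bundle.RiemannianBundle (fun x : M => TangentSpace (𝓡 m) x) := ⟨g.toRiemannianMetric⟩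
  Manifold.riemannianEDist_le_pathELength hγ rfl rfl zero_le_one

lemma metricEDist_comm (g : SmoothRiemannianMetric m M) (p q : M) :
    metricEDist g p q = metricEDist g q p :=
  letI : Bundle.RiemannianBundle (fun x : M => TangentSpace (𝓡 m) x) := ⟨g.toRiemannianMetric⟩
  Manifold.riemannianEDist_comm

lemma exists_metricLength_lt {g : SmoothRiemannianMetric m M} {p q : M} {r : ENNReal}
    (h : metricEDist g p q < r) : ∃ γ : ℝ → M, γ 0 = p ∧ γ 1 = q ∧
      ContMDiffOn 𝓘(ℝ, ℝ) (𝓡 m) 1 γ (Icc 0 1) ∧ metricLength g γ < r :=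
  letI : Bundle.RiemannianBundle (fun x : M => TangentSpace (𝓡 m) x) := ⟨g.toRiemannianMetric⟩
  Manifold.exists_lt_of_riemannianEDist_lt h

/-- Short paths starting near a point remain in a given neighborhood of the point. -/
lemma exists_forall_mem_of_metricLength_lt [T2Space M] (g : SmoothRiemannianMetric m M) {p₀ : M}
    {W : Set M} (hW : W ∈ 𝓝 p₀) : ∃ c > (0 : ENNReal), ∃ W' ∈ 𝓝 p₀, ∀ γ : ℝ → M, γ 0 ∈ W' →
      ContMDiffOn 𝓘(ℝ, ℝ) (𝓡 m) 1 γ (Icc 0 1) → metricLength g γ < c →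
      ∀ t ∈ Icc (0 : ℝ) 1, γ t ∈ W := by
  let : Bundle.RiemannianBundle (fun x : M => TangentSpace (𝓡 m) x) := ⟨g.toRiemannianMetric⟩
  have : IsContMDiffRiemannianBundle (𝓡 m) ∞ (EuclideanSpace ℝ (Fin m))
    (fun x : M => TangentSpace (𝓡 m) x) := ⟨g.inner, g.contMDiff, fun _ _ _ => rfl⟩
  have : IsContinuousRiemannianBundle (EuclideanSpace ℝ (Fin m))
    (fun x : M => TangentSpace (𝓡 m) x) := ⟨⟨g.inner, g.contMDiff.continuous, fun _ _ _ => rfl⟩⟩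
  have : LocallyCompactSpace M := Manifold.locallyCompact_of_finiteDimensional (𝓡 m)
  have : IsManifold (𝓡 m) 1 M := IsManifold.of_le (n := ∞) (by simp)
  obtain ⟨c, hc, hcW⟩ := setOfPred_riemannianEDist_lt_subset_nhds' (𝓡 m) hW
  refine ⟨c / 2, ENNReal.half_pos hc.ne', _,
    eventually_riemannianEDist_lt (𝓡 m) p₀ (ENNReal.half_pos hc.ne'), fun γ h0 hγ hlen t ht => ?_⟩
  apply hcW
  have h1 : Manifold.riemannianEDist (𝓡 m) (γ 0) (γ t) < c / 2 :=
    ((Manifold.riemannianEDist_le_pathELength (hγ.mono (Icc_subset_Icc_right ht.2)) rfl rfl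
      ht.1).trans (Manifold.pathELength_mono le_rfl ht.2)).trans_lt hlen
  have h2 : Manifold.riemannianEDist (𝓡 m) p₀ (γ 0) < c / 2 := h0
  calc Manifold.riemannianEDist (𝓡 m) p₀ (γ t)
      ≤ Manifold.riemannianEDist (𝓡 m) p₀ (γ 0) + Manifold.riemannianEDist (𝓡 m) (γ 0) (γ t) :=
        Manifold.riemannianEDist_triangle
    _ < c / 2 + c / 2 := ENNReal.add_lt_add h2 h1
    _ = c := ENNReal.add_halves c

end Length

/-! ### Riemannian metrics in coordinates -/

section Coordinates

open MeasureTheory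

variable {m : ℕ} {M : Type*} [TopologicalSpace M] [ChartedSpace (EuclideanSpace ℝ (Fin m)) M]
  [IsManifold (𝓡 m) ∞ M] {V : Type} [NormedAddCommGroup V] [NormedSpace ℝ V]

/-- The metric `g` in the coordinates given by the chart `ψ`. -/
noncomputable def coordMetric (g : SmoothRiemannianMetric m M) (ψ : OpenPartialHomeomorph M V)
    (z : V) : V →L[ℝ] V →L[ℝ] ℝ :=
  let A : V →L[ℝ] EuclideanSpace ℝ (Fin m) := mfderiv 𝓘(ℝ, V) (𝓡 m) ψ.symm z
  let q : EuclideanSpace ℝ (Fin m) →L[ℝ] EuclideanSpace ℝ (Fin m) →L[ℝ] ℝ := g.inner (ψ.symm z)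
  q.bilinearComp A A

lemma coordMetric_apply (g : SmoothRiemannianMetric m M) (ψ : OpenPartialHomeomorph M V)
    (z v w : V) : coordMetric g ψ z v w = g.inner (ψ.symm z)
      (mfderiv 𝓘(ℝ, V) (𝓡 m) ψ.symm z v) (mfderiv 𝓘(ℝ, V) (𝓡 m) ψ.symm z w) := rfl

lemma coordMetric_symm (g : SmoothRiemannianMetric m M) (ψ : OpenPartialHomeomorph M V)
    (z v w : V) : coordMetric g ψ z v w = coordMetric g ψ z w v :=
  g.symm _ _ _

variable {ψ : OpenPartialHomeomorph M V}

lemma coordMetric_pos (g : SmoothRiemannianMetric m M)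
    (hψ : ContMDiffOn (𝓡 m) 𝓘(ℝ, V) ∞ ψ ψ.source)
    (hψ' : ContMDiffOn 𝓘(ℝ, V) (𝓡 m) ∞ ψ.symm ψ.target) {z : V} (hz : z ∈ ψ.target) {v : V}
    (hv : v ≠ 0) : 0 < coordMetric g ψ z v v := by
  refine g.pos _ _ fun h0 => hv ?_
  have h1 : MDifferentiableAt 𝓘(ℝ, V) (𝓡 m) ψ.symm z :=
    (hψ'.contMDiffAt (ψ.open_target.mem_nhds hz)).mdifferentiableAt (by simp)
  have h2 : MDifferentiableAt (𝓡 m) 𝓘(ℝ, V) ψ (ψ.symm z) :=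
    (hψ.contMDiffAt (ψ.open_source.mem_nhds (ψ.map_target hz))).mdifferentiableAt (by simp)
  have h3 := mfderiv_comp z h2 h1
  have h4 : mfderiv 𝓘(ℝ, V) 𝓘(ℝ, V) (ψ ∘ ψ.symm) z = mfderiv 𝓘(ℝ, V) 𝓘(ℝ, V) id z := by
    refine Filter.EventuallyEq.mfderiv_eq ?_
    filter_upwards [ψ.open_target.mem_nhds hz] with y hy using ψ.right_inv hy
  rw [h4, mfderiv_id] at h3
  have h5 : v = mfderiv (𝓡 m) 𝓘(ℝ, V) ψ (ψ.symm z) (mfderiv 𝓘(ℝ, V) (𝓡 m) ψ.symm z v) :=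
    congrArg (fun L : V →L[ℝ] V => L v) h3
  exact h5.trans ((congrArg (mfderiv (𝓡 m) 𝓘(ℝ, V) ψ (ψ.symm z)) h0).trans (map_zero _))

lemma contDiffOn_coordMetric [FiniteDimensional ℝ V] (g : SmoothRiemannianMetric m M)
    (hψ' : ContMDiffOn 𝓘(ℝ, V) (𝓡 m) ∞ ψ.symm ψ.target) :
    ContDiffOn ℝ ∞ (coordMetric g ψ) ψ.target := by
  let : Bundle.RiemannianBundle (fun x : M => TangentSpace (𝓡 m) x) := ⟨g.toRiemannianMetric⟩
  have : IsContMDiffRiemannianBundle (𝓡 m) ∞ (EuclideanSpace ℝ (Fin m))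
    (fun x : M => TangentSpace (𝓡 m) x) := ⟨g.inner, g.contMDiff, fun _ _ _ => rfl⟩
  have hU : UniqueMDiffOn 𝓘(ℝ, V) ψ.target := ψ.open_target.uniqueMDiffOn
  have h1 : ContMDiffOn 𝓘(ℝ, V).tangent (𝓡 m).tangent ∞
      (tangentMapWithin 𝓘(ℝ, V) (𝓡 m) ψ.symm ψ.target) (Bundle.TotalSpace.proj ⁻¹' ψ.target) :=
    hψ'.contMDiffOn_tangentMapWithin (by simp) hU
  have h2 : ∀ v : V, ContMDiffOn 𝓘(ℝ, V) (𝓡 m).tangent ∞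
      (fun z => (⟨ψ.symm z, mfderiv 𝓘(ℝ, V) (𝓡 m) ψ.symm z v⟩ : TangentBundle (𝓡 m) M))
      ψ.target := by
    intro v
    have h3 : ContMDiff 𝓘(ℝ, V) 𝓘(ℝ, V).tangent ∞ (fun z : V => (⟨z, v⟩ : TangentBundle 𝓘(ℝ, V) V)) := by
      exact contMDiff_vectorSpace_iff_contDiff.2 contDiff_const
    refine (h1.comp h3.contMDiffOn fun z hz => hz).congr fun z hz => ?_
    simp only [Function.comp_apply, tangentMapWithin]
    rw [mfderivWithin_of_isOpen ψ.open_target hz]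
  rw [contDiffOn_clm_apply]
  intro v
  rw [contDiffOn_clm_apply]
  intro w
  rw [← contMDiffOn_iff_contDiffOn]
  exact (h2 v).inner_bundle (h2 w)

/-- The length of a path in coordinates. -/
lemma metricLength_comp_symm (g : SmoothRiemannianMetric m M)
    (hψ' : ContMDiffOn 𝓘(ℝ, V) (𝓡 m) ∞ ψ.symm ψ.target) {δ : ℝ → V}
    (hδ : ContDiffOn ℝ 1 δ (Icc 0 1)) (hδψ : ∀ t ∈ Icc (0 : ℝ) 1, δ t ∈ ψ.target) :
    metricLength g (fun t => ψ.symm (δ t)) = ∫⁻ t in Icc (0 : ℝ) 1, ENNReal.ofReal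
      √(coordMetric g ψ (δ t) (derivWithin δ (Icc 0 1) t) (derivWithin δ (Icc 0 1) t)) := by
  rw [metricLength_eq]
  refine setLIntegral_congr_fun measurableSet_Icc fun t ht => ?_
  have h1 : MDifferentiableAt 𝓘(ℝ, V) (𝓡 m) ψ.symm (δ t) :=
    (hψ'.contMDiffAt (ψ.open_target.mem_nhds (hδψ t ht))).mdifferentiableAt (by simp)
  have h2 : MDifferentiableWithinAt 𝓘(ℝ, ℝ) 𝓘(ℝ, V) δ (Icc 0 1) t :=
    (hδ.differentiableOn (by simp) t ht).mdifferentiableWithinAt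
  have hu : UniqueMDiffWithinAt 𝓘(ℝ, ℝ) (Icc (0 : ℝ) 1) t :=
    (uniqueDiffOn_Icc zero_lt_one t ht).uniqueMDiffWithinAt
  have h3 := mfderiv_comp_mfderivWithin t h1 h2 hu
  have h4 : mfderivWithin 𝓘(ℝ, ℝ) (𝓡 m) (fun t => ψ.symm (δ t)) (Icc 0 1) t (1 : ℝ) =
      mfderiv 𝓘(ℝ, V) (𝓡 m) ψ.symm (δ t) (derivWithin δ (Icc 0 1) t) := by
    have h5 : mfderivWithin 𝓘(ℝ, ℝ) 𝓘(ℝ, V) δ (Icc 0 1) t (1 : ℝ) = derivWithin δ (Icc 0 1) t :=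
      (congrArg (fun L : ℝ →L[ℝ] V => L 1) mfderivWithin_eq_fderivWithin).trans
        fderivWithin_derivWithin
    exact (congrArg (fun L : ℝ →L[ℝ] EuclideanSpace ℝ (Fin m) => L 1) h3).trans
      (congrArg (mfderiv 𝓘(ℝ, V) (𝓡 m) ψ.symm (δ t)) h5)
  rw [coordMetric_apply, h4]
  rfl

end Coordinates

/-! ### The distance to a slice in coordinates -/

section Distance

open MeasureTheory

variable {V : Type} [NormedAddCommGroup V] [NormedSpace ℝ V] {q : V → V → ℝ} {Z O Ω : Set V}
  {T : V → ℝ}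

/-- Every path in `O` ending in `Z` is at least as long as `√T` at its starting point. -/
lemma IsEikonalSquare.ofReal_sqrt_le_lintegral (h : IsEikonalSquare q Z O Ω T) (hO : IsOpen O)
    {δ : ℝ → V} (hδ : ContDiffOn ℝ 1 δ (Icc 0 1)) (hδO : ∀ t ∈ Icc (0 : ℝ) 1, δ t ∈ O)
    (h1 : δ 1 ∈ Z) : ENNReal.ofReal √(T (δ 0)) ≤
      ∫⁻ t in Icc (0 : ℝ) 1, ENNReal.ofReal √(q (δ t) (derivWithin δ (Icc 0 1) t)) := by
  refine ENNReal.le_of_forall_pos_le_add fun η hη _ => ?_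
  have hη' : (0 : ℝ) < η := hη
  -- `√T` need not be differentiable at the points of `Z`
  let f : ℝ → ℝ := fun t => √(T (δ t) + η ^ 2)
  have hpos : ∀ t ∈ Icc (0 : ℝ) 1, 0 < T (δ t) + (η : ℝ) ^ 2 := fun t ht =>
    add_pos_of_nonneg_of_pos (h.nonneg _ (hδO t ht)) (by positivity)
  have hf : ContDiffOn ℝ 1 f (Icc 0 1) :=
    (((h.contDiffOn.of_le (by simp)).comp hδ hδO).add contDiffOn_const).sqrt
      fun t ht => (hpos t ht).ne'
  have key := enorm_sub_le_lintegral_derivWithin_Icc_of_contDiffOn_Icc hf zero_le_one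
  have hbound : ∫⁻ t in Icc (0 : ℝ) 1, ‖derivWithin f (Icc 0 1) t‖ₑ ≤
      ∫⁻ t in Icc (0 : ℝ) 1, ENNReal.ofReal √(q (δ t) (derivWithin δ (Icc 0 1) t)) := by
    refine setLIntegral_mono' measurableSet_Icc fun t ht => ?_
    have hT : HasFDerivAt T (fderiv ℝ T (δ t)) (δ t) :=
      ((h.contDiffOn.contDiffAt (hO.mem_nhds (hδO t ht))).differentiableAt (by simp)).hasFDerivAt
    have hd : HasDerivWithinAt δ (derivWithin δ (Icc 0 1) t) (Icc 0 1) t :=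
      (hδ.differentiableOn (by simp) t ht).hasDerivWithinAt
    have hfd : HasDerivWithinAt f (fderiv ℝ T (δ t) (derivWithin δ (Icc 0 1) t) /
        (2 * √(T (δ t) + η ^ 2))) (Icc 0 1) t :=
      ((hT.comp_hasDerivWithinAt t hd).add_const ((η : ℝ) ^ 2)).sqrt (hpos t ht).ne'
    rw [hfd.derivWithin (uniqueDiffOn_Icc zero_lt_one t ht), ← ofReal_norm]
    refine ENNReal.ofReal_le_ofReal ?_
    generalize derivWithin δ (Icc 0 1) t = v
    have hsq := h.sq_fderiv_le _ (hδO t ht) v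
    have hp := hpos t ht
    rcases (h.nonneg _ (hδO t ht)).eq_or_lt with h0 | h0
    · rw [← h0, mul_zero, zero_mul] at hsq
      rw [pow_eq_zero_iff two_ne_zero |>.1 (le_antisymm hsq (sq_nonneg _))]
      simp
    · have hq : 0 ≤ q (δ t) v := nonneg_of_mul_nonneg_right ((sq_nonneg _).trans hsq) (by positivity)
      refine Real.abs_le_sqrt ?_
      rw [div_pow, mul_pow, Real.sq_sqrt hp.le, div_le_iff₀ (by positivity)]
      nlinarith [mul_nonneg hq (sq_nonneg (η : ℝ))]
  have hf1 : f 1 = η := by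
    have : T (δ 1) = 0 := (h.eq_zero_iff _ (hδO 1 (right_mem_Icc.2 zero_le_one))).2 h1
    simp [f, this]
  calc ENNReal.ofReal √(T (δ 0)) ≤ ENNReal.ofReal (‖f 1 - f 0‖ + η) := by
        refine ENNReal.ofReal_le_ofReal ?_
        have h2 : √(T (δ 0)) ≤ f 0 := Real.sqrt_le_sqrt (by nlinarith)
        have h3 := neg_abs_le (f 1 - f 0)
        rw [Real.norm_eq_abs]
        linarith
    _ = ‖f 1 - f 0‖ₑ + η := by
        rw [ENNReal.ofReal_add (norm_nonneg _) hη'.le, ofReal_norm, ENNReal.ofReal_coe_nnreal]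
    _ ≤ _ := by gcongr; exact key.trans hbound

/-- Every point of `O` is joined to `Z` by a path of length `√T`. -/
lemma IsEikonalSquare.exists_lintegral_eq (h : IsEikonalSquare q Z O Ω T) {z : V} (hz : z ∈ O) :
    ∃ c : ℝ → V, ContDiff ℝ 1 c ∧ c 0 ∈ Z ∧ c 1 = z ∧ (∀ τ ∈ Icc (0 : ℝ) 1, c τ ∈ Ω) ∧
      ∫⁻ t in Icc (0 : ℝ) 1, ENNReal.ofReal √(q (c t) (derivWithin c (Icc 0 1) t)) =
        ENNReal.ofReal √(T z) := by
  obtain ⟨c, hc, h0, h1, hΩ, ℓ, hℓ, hℓc, hint⟩ := h.exists_curve z hz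
  refine ⟨c, hc, h0, h1, hΩ, ?_⟩
  rw [← hint, intervalIntegral.integral_of_le zero_le_one, ← integral_Icc_eq_integral_Ioc,
    ofReal_integral_eq_lintegral_ofReal]
  · refine setLIntegral_congr_fun measurableSet_Icc fun t ht => ?_
    rw [((hc.differentiable (by simp)) t).derivWithin (uniqueDiffOn_Icc zero_lt_one t ht),
      (hℓc t ht).2, Real.sqrt_sq (hℓc t ht).1]
  · exact hℓ.integrableOn_Icc
  · exact (ae_restrict_iff' measurableSet_Icc).2 (ae_of_all _ fun t ht => (hℓc t ht).1)

variable {m : ℕ} {M : Type*} [TopologicalSpace M] [ChartedSpace (EuclideanSpace ℝ (Fin m)) M]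
  [IsManifold (𝓡 m) ∞ M] [T2Space M] {ψ : OpenPartialHomeomorph M V}

/-- In a chart, the distance to a set is the square root of a solution of the eikonal equation,
near the points of the set. -/
theorem IsEikonalSquare.eventually_metricInfEDist_eq (g : SmoothRiemannianMetric m M)
    (hψ : ContMDiffOn (𝓡 m) 𝓘(ℝ, V) ∞ ψ ψ.source)
    (hψ' : ContMDiffOn 𝓘(ℝ, V) (𝓡 m) ∞ ψ.symm ψ.target) {A : Set M}
    (hA : ∀ p ∈ ψ.source, p ∈ A ↔ ψ p ∈ Z)
    (h : IsEikonalSquare (fun z v => coordMetric g ψ z v v) Z O Ω T) (hO : IsOpen O)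
    (hΩ : Ω ⊆ ψ.target) {p₀ : M} (hp₀ : p₀ ∈ ψ.source) (hp₀O : ψ p₀ ∈ O) (hp₀A : p₀ ∈ A) :
    ∀ᶠ p in 𝓝 p₀, metricInfEDist g A p = ENNReal.ofReal √(T (ψ p)) := by
  have hW : ψ.source ∩ ψ ⁻¹' O ∈ 𝓝 p₀ :=
    (ψ.isOpen_inter_preimage hO).mem_nhds ⟨hp₀, hp₀O⟩
  obtain ⟨c, hc, W', hW', hshort⟩ := exists_forall_mem_of_metricLength_lt g hW
  have hT0 : T (ψ p₀) = 0 := (h.eq_zero_iff _ hp₀O).2 ((hA _ hp₀).1 hp₀A)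
  have hcont : ContinuousAt (fun p => ENNReal.ofReal √(T (ψ p))) p₀ := by
    have h1 : ContinuousAt T (ψ p₀) := h.contDiffOn.continuousOn.continuousAt (hO.mem_nhds hp₀O)
    have h2 : ContinuousAt (fun p => T (ψ p)) p₀ := h1.comp (ψ.continuousAt hp₀)
    exact ENNReal.continuous_ofReal.continuousAt.comp (Real.continuous_sqrt.continuousAt.comp h2)
  have hsmall : ∀ᶠ p in 𝓝 p₀, ENNReal.ofReal √(T (ψ p)) < c :=
    hcont.eventually_lt continuousAt_const (by simpa [hT0] using hc)
  filter_upwards [hW, hW', hsmall] with p hp hpW' hpc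
  refine le_antisymm ?_ ?_
  · obtain ⟨γ, hγ, h0, h1, hγΩ, hlen⟩ := h.exists_lintegral_eq hp.2
    have hγψ : ∀ t ∈ Icc (0 : ℝ) 1, γ t ∈ ψ.target := fun t ht => hΩ (hγΩ t ht)
    have h0ψ := hγψ 0 (left_mem_Icc.2 zero_le_one)
    have hmem : ψ.symm (γ 0) ∈ A := by
      rw [hA _ (ψ.map_target h0ψ), ψ.right_inv h0ψ]
      exact h0
    have hsmooth : ContMDiffOn 𝓘(ℝ, ℝ) (𝓡 m) 1 (fun t => ψ.symm (γ t)) (Icc 0 1) :=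
      (hψ'.of_le (by simp)).comp hγ.contMDiff.contMDiffOn hγψ
    have h2 := metricEDist_le_metricLength g hsmooth
    rw [metricLength_comp_symm g hψ' hγ.contDiffOn hγψ, hlen, h1, ψ.left_inv hp.1,
      metricEDist_comm] at h2
    exact (iInf₂_le _ hmem).trans h2
  · refine le_iInf₂ fun y hy => le_of_forall_gt fun r hr => ?_
    rcases le_or_gt c r with hcr | hrc
    · exact hpc.trans_le hcr
    · obtain ⟨γ, h0, h1, hγ, hlen⟩ := exists_metricLength_lt hr
      have hγW := hshort γ (h0 ▸ hpW') hγ (hlen.trans hrc)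
      have hδ : ContDiffOn ℝ 1 (fun t => ψ (γ t)) (Icc 0 1) :=
        contMDiffOn_iff_contDiffOn.1 ((hψ.of_le (by simp)).comp hγ fun t ht => (hγW t ht).1)
      have h1mem := hγW 1 (right_mem_Icc.2 zero_le_one)
      have h2 := h.ofReal_sqrt_le_lintegral hO hδ (fun t ht => (hγW t ht).2)
        ((hA _ h1mem.1).1 (h1 ▸ hy))
      rw [← metricLength_comp_symm g hψ' hδ fun t ht => ψ.map_source (hγW t ht).1, h0,
        metricLength_congr g (γ' := γ) fun t ht => ψ.left_inv (hγW t ht).1] at h2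
      exact h2.trans_lt hlen

end Distance

/-! ### The quotient of the distances -/

section Ratio

/-- The theorem near a single point of the submanifold. -/
theorem exists_nhds_contMDiffOn_eq_div {n m : ℕ} {M : Type*} [TopologicalSpace M] [T2Space M]
    [ChartedSpace (EuclideanSpace ℝ (Fin m)) M] [IsManifold (𝓡 m) ∞ M]
    {S : Type*} [TopologicalSpace S] [ChartedSpace (EuclideanSpace ℝ (Fin n)) S]
    [IsManifold (𝓡 n) ∞ S] {ι : S → M} (hι : Manifold.IsSmoothEmbedding (𝓡 n) (𝓡 m) ∞ ι)
    {g g' : SmoothRiemannianMetric m M} {φ : M → ℝ} (hφ : IsConformalChange φ g g') (s : S) :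
    ∃ U : Set M, IsOpen U ∧ ι s ∈ U ∧ ∃ κ : M → ℝ, ContMDiffOn (𝓡 m) 𝓘(ℝ) ∞ κ U ∧
      (∀ p ∈ U \ range ι,
        (0 < metricInfEDist g (range ι) p ∧ metricInfEDist g (range ι) p < ⊤) ∧
        (0 < metricInfEDist g' (range ι) p ∧ metricInfEDist g' (range ι) p < ⊤) ∧
        κ p = (metricInfEDist g' (range ι) p).toReal / (metricInfEDist g (range ι) p).toReal) ∧
      ∀ p ∈ U ∩ range ι, κ p = Real.exp (φ p) := by
  obtain ⟨F, _, _, _, ψ, hs, hψ, hψ', hslice⟩ := exists_slice_chart hι s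
  have hconf : ∀ z v w, coordMetric g' ψ z v w =
      Real.exp (2 * φ (ψ.symm z)) * coordMetric g ψ z v w := fun z v w => hφ.inner_eq _ _ _
  have hP : ContDiffOn ℝ ∞ (fun z => Real.exp (2 * φ (ψ.symm z))) ψ.target :=
    (contDiffOn_const.mul (contMDiffOn_iff_contDiffOn.1 (hφ.smooth.comp_contMDiffOn hψ'))).exp
  have hz₀ : ψ (ι s) = ((ψ (ι s)).1, 0) := Prod.ext rfl ((hslice _ hs).1 (mem_range_self s))
  obtain ⟨O, hO, hzO, hOψ, T₁, T₂, K, hT₁, hT₂, hK, hTK⟩ :=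
    exists_isEikonalSquare_conformal ψ.open_target (contDiffOn_coordMetric g hψ')
      (fun z _ => coordMetric_symm g ψ z) (fun z hz v => coordMetric_pos g hψ hψ' hz)
      hP (fun z _ => Real.exp_pos _) (x₀ := (ψ (ι s)).1) (hz₀ ▸ ψ.map_source hs)
  rw [← hz₀] at hzO
  simp only [← hconf] at hT₁
  have h₁ := hT₁.eventually_metricInfEDist_eq g' hψ hψ' hslice hO Subset.rfl hs hzO
    (mem_range_self s)
  have h₂ := hT₂.eventually_metricInfEDist_eq g hψ hψ' hslice hO Subset.rfl hs hzO
    (mem_range_self s)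
  have hW : ψ.source ∩ ψ ⁻¹' O ∈ 𝓝 (ι s) :=
    (ψ.isOpen_inter_preimage hO).mem_nhds ⟨hs, hzO⟩
  obtain ⟨U, hU, hUo, hsU⟩ := mem_nhds_iff.1 ((h₁.and h₂).and hW)
  refine ⟨U, hUo, hsU, fun p => √(K (ψ p)), ?_, fun p hp => ?_, fun p hp => ?_⟩
  · have hK' : ContDiffOn ℝ ∞ (fun z => √(K z)) O := hK.sqrt fun z hz => (hTK z hz).1.ne'
    exact hK'.contMDiffOn.comp (hψ.mono fun p hp => (hU hp).2.1) fun p hp => (hU hp).2.2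
  · obtain ⟨⟨hp₁, hp₂⟩, hpψ, hpO⟩ := hU hp.1
    obtain ⟨hKpos, hTT, -⟩ := hTK _ hpO
    have hne : T₂ (ψ p) ≠ 0 := fun h0 =>
      hp.2 ((hslice p hpψ).2 ((hT₂.eq_zero_iff _ hpO).1 h0))
    have hT₂pos : 0 < T₂ (ψ p) := (hT₂.nonneg _ hpO).lt_of_ne' hne
    have hT₁pos : 0 < T₁ (ψ p) := hTT ▸ mul_pos hKpos hT₂pos
    rw [hp₁, hp₂]
    refine ⟨⟨?_, ENNReal.ofReal_lt_top⟩, ⟨?_, ENNReal.ofReal_lt_top⟩, ?_⟩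
    · exact ENNReal.ofReal_pos.2 (Real.sqrt_pos.2 hT₂pos)
    · exact ENNReal.ofReal_pos.2 (Real.sqrt_pos.2 hT₁pos)
    · rw [ENNReal.toReal_ofReal (Real.sqrt_nonneg _), ENNReal.toReal_ofReal (Real.sqrt_nonneg _),
        hTT, Real.sqrt_mul hKpos.le, mul_div_cancel_right₀ _ (Real.sqrt_pos.2 hT₂pos).ne']
  · obtain ⟨-, hpψ, hpO⟩ := hU hp.1
    beta_reduce
    rw [(hTK _ hpO).2.2 ((hslice p hpψ).1 hp.2), ψ.left_inv hpψ, two_mul, Real.exp_add,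
      Real.sqrt_mul_self (Real.exp_pos _).le]

end Ratio

end

theorem mainTheorem4 (n k : ℕ)
    {M : Type*} [TopologicalSpace M] [T2Space M] [SecondCountableTopology M]
    [ChartedSpace (EuclideanSpace ℝ (Fin (n + k))) M] [IsManifold (𝓡 (n + k)) ∞ M]
    {S : Type*} [TopologicalSpace S] [CompactSpace S]
    [ChartedSpace (EuclideanSpace ℝ (Fin n)) S] [IsManifold (𝓡 n) ∞ S]
    (ι : S → M) (hι : Manifold.IsSmoothEmbedding (𝓡 n) (𝓡 (n + k)) ∞ ι)
    (g g' : SmoothRiemannianMetric (n + k) M) (φ : M → ℝ) (hφ : IsConformalChange φ g g') :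
    ∃ U : Set M, IsOpen U ∧ Set.range ι ⊆ U ∧
      -- off the submanifold, both distances to it are positive and finite on `U`
      (∀ p ∈ U \ Set.range ι,
        (0 < metricInfEDist g (Set.range ι) p ∧ metricInfEDist g (Set.range ι) p < ⊤) ∧
        (0 < metricInfEDist g' (Set.range ι) p ∧ metricInfEDist g' (Set.range ι) p < ⊤)) ∧
      ∃ Ψ : M → ℝ, ContMDiffOn (𝓡 (n + k)) 𝓘(ℝ) ∞ Ψ U ∧
        (∀ p ∈ U \ Set.range ι,
          Ψ p = (metricInfEDist g' (Set.range ι) p).toReal /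
            (metricInfEDist g (Set.range ι) p).toReal) ∧
        ∀ p ∈ Set.range ι, Ψ p = Real.exp (φ p) := by
  classical
  choose U hUo hsU κ hκ hoff hon using exists_nhds_contMDiffOn_eq_div hι hφ
  let Ψ : M → ℝ := fun p => if p ∈ Set.range ι then Real.exp (φ p) else
    (metricInfEDist g' (Set.range ι) p).toReal / (metricInfEDist g (Set.range ι) p).toReal
  have hΨ : ∀ s, ∀ p ∈ U s, Ψ p = κ s p := fun s p hp => by
    by_cases h : p ∈ Set.range ι
    · rw [hon s p ⟨hp, h⟩]
      exact if_pos h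
    · rw [(hoff s p ⟨hp, h⟩).2.2]
      exact if_neg h
  refine ⟨⋃ s, U s, isOpen_iUnion hUo, ?_, fun p hp => ?_, Ψ, fun p hp => ?_, fun p hp => if_neg hp.2,
    fun p hp => if_pos hp⟩
  · rintro _ ⟨s, rfl⟩
    exact Set.mem_iUnion.2 ⟨s, hsU s⟩
  · obtain ⟨s, hs⟩ := Set.mem_iUnion.1 hp.1
    exact ⟨(hoff s p ⟨hs, hp.2⟩).1, (hoff s p ⟨hs, hp.2⟩).2.1⟩
  · obtain ⟨s, hs⟩ := Set.mem_iUnion.1 hp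
    have h1 : ContMDiffAt (𝓡 (n + k)) 𝓘(ℝ) ∞ (κ s) p := (hκ s).contMDiffAt ((hUo s).mem_nhds hs)
    refine (h1.congr_of_eventuallyEq ?_).contMDiffWithinAt
    filter_upwards [(hUo s).mem_nhds hs] with y hy using hΨ s y hy
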